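/- Let $q$ be a prime power and let $r\ge 1$, $\delta\ge 2$, $N\ge 2$, $n$ be integers. For a linear code $\mathcal C$ let $d(\mathcal C)$ be its minimum Hamming distance (with $d(\{0\})=\infty$). A linear code $\mathcal C$ of length $n$ is an $(r,\delta)$-LRC if every coordinate $i$ lies in a set $S$ of at most $r+\delta-1$ coordinates such that the restriction $\mathcal C|_{S}$ satisfies $d(\mathcal C|_S)\ge\delta$; an $(r,\delta)$-LRC with parameters $[n,k,d]$ is optimal if $d=n-k+1-(\lceil k/r\rceil-1)(\delta-1)$. Write $\mathcal C^{\perp}$ for the Hermitian dual $\{x:\sum_i x_iy_i^q=0\ \forall y\in\mathcal C\}$ of a code over $\mathbb F_{q^2}$ (respectively, for the Euclidean dual $\{x:\sum_i x_iy_i=0\ \forall y\in\mathcal C\}$ of a code over $\mathbb F_q$). If $\mathcal C^\perp\subseteq\mathcal C$, then $\mathcal C$, of length $m$, induces stabilizer quantum codes over $\mathbb F_q$, of parameters $[[m,\,2\dim\mathcal C-m,\,\ge d(\mathcal C)]]_q$, whose stabilizer consists, up to scalar factors, of the error operators $X(a)Z(b)$ such that $\beta a+\gamma b\in\mathcal C^\perp$,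 where $\beta,\gamma$ is an $\mathbb F_q$-basis of $\mathbb F_{q^2}$ (respectively, such that $a,b\in\mathcal C^\perp$). The code $\mathcal C$ is said to induce an optimal quantum $(r,\delta)$-LRC with parameters $[[m,k,d]]_q$ if $\mathcal C^\perp\subseteq\mathcal C$, $2\dim\mathcal C=m+k$, $d=d(\mathcal C)$, $\mathcal C$ is an $(r,\delta)$-LRC, $\delta\le d(\mathcal C^\perp)$, the induced quantum codes have parameters $[[m,k,\ge d]]_q$, and $$k+2d+2\Big(\Big\lceil\frac{m+k}{2r}\Big\rceil-1\Big)(\delta-1)=m+2 .$$ Let $A=(a_{l,j})$ be an invertible $N\times N$ matrix over $\mathbb F_{q^2}$ (respectively $\mathbb F_q$), and let $\mathcal C_1\supseteq\dots\supseteq\mathcal C_N$ be optimal $(r,\delta)$-LRCs over the same field, $\mathcal C_i$ having parameters $[n,k_i,d_i]$. Put $B=A A^{\dagger}$ with $A^\dagger=(a_{j,l}^q)_{l,j}$ (respectively $B=AA^{\top}$), and let $\tau$ be a permutation of $\{1,\dots,N\}$ such that, for every $i$, $\tau(i)$ is the least $s\notin\{\tau(1),\dots,\tau(i-1)\}$ for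 which the minor of $B$ on the rows $1,\dots,i$ and the columns $\tau(1),\dots,\tau(i-1),s$ is nonzero. Suppose that $\mathcal C_{\tau(i)}^{\perp}\subseteq\mathcal C_i$ for every $i$. Let $$\mathcal C(A)=\Big\{\Big(\sum_l a_{l,1}c_l,\dots,\sum_l a_{l,N}c_l\Big): c_l\in\mathcal C_l\Big\},$$ a code of length $Nn$, and let $D_{N-1}(A)$ be the minimum distance of the code generated by the first $N-1$ rows of $A$. Then $\mathcal C(A)$ induces an optimal quantum $(r,\delta)$-LRC if and only if one of the following cases holds. Case I: $D_{N-1}(A)=1$, $\mathcal C_1=\dots=\mathcal C_N$, $d_1=\dots=d_N=\delta$, and $\lceil Nk_1/r\rceil=N\lceil k_1/r\rceil$. Case II: $D_{N-1}(A)=2$, $\mathcal C_1=\dots=\mathcal C_{N-1}$, $d_1=\dots=d_{N-1}=\delta$, $d_N\le 2\delta$, and $\big\lceil\frac{(N-1)k_1+k_N}{r}\big\rceil=(N-1)\lceil k_1/r\rceil+\lceil k_N/r\rceil$. Moreover, the optimal quantum $(r,\delta)$-LRC induced by $\mathcal C(A)$ has parameters $[[Nn,\,2Nk_1-Nn,\,\delta]]_q$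 in Case I and $[[Nn,\,2(N-1)k_1+2k_N-Nn,\,d_N]]_q$ in Case II. -/

import Mathlib

/-! ### Linear codes -/

open Classical in
/-- Minimum Hamming distance of a linear code: the least weight of a nonzero codeword.
The zero code has no nonzero codeword and gets `⊤`. -/
noncomputable def minDist {L ι : Type*} [Field L] [Fintype ι] (C : Submodule L (ι → L)) : ℕ∞ :=
  ⨅ x ∈ C, ⨅ _ : x ≠ 0, (hammingNorm x : ℕ∞)

/-- The Euclidean dual `{x | ∑ x_i y_i = 0 for all y ∈ C}`. -/
def euclideanDual {L ι : Type*} [Field L] [Fintype ι] (C : Submodule L (ι → L)) :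
    Submodule L (ι → L) where
  carrier := {x | ∀ y ∈ C, ∑ i, x i * y i = 0}
  add_mem' := by
    intro x x' hx hx' y hy
    simp [add_mul, Finset.sum_add_distrib, hx y hy, hx' y hy]
  zero_mem' := by intro y _; simp
  smul_mem' := by
    intro c x hx y hy
    simp [mul_assoc, ← Finset.mul_sum, hx y hy]

/-- The Hermitian dual `{x | ∑ x_i y_i ^ q = 0 for all y ∈ C}`, for a code over a field with
`q ^ 2` elements. -/
def hermitianDual {L ι : Type*} [Field L] [Fintype ι] (q : ℕ) (C : Submodule L (ι → L)) :
    Submodule L (ι → L) where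
  carrier := {x | ∀ y ∈ C, ∑ i, x i * y i ^ q = 0}
  add_mem' := by
    intro x x' hx hx' y hy
    simp [add_mul, Finset.sum_add_distrib, hx y hy, hx' y hy]
  zero_mem' := by intro y _; simp
  smul_mem' := by
    intro c x hx y hy
    simp [mul_assoc, ← Finset.mul_sum, hx y hy]

/-- The conjugate transpose `(b_{j,i} ^ q)` of a matrix over a field with `q ^ 2` elements. -/
def conjTransposeQ {L m n : Type*} [Field L] (q : ℕ) (A : Matrix m n L) : Matrix n m L :=
  A.transpose.map (fun x => x ^ q)

/-! ### Matrix-product codes -/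

/-- The matrix-product code `[C_1, …, C_N] · A`. The codeword built from `c_l ∈ C_l` has
`∑_l a_{l,j} c_l` as its `j`-th block; the coordinate `(j, i)` is the `i`-th one of block `j`. -/
def mpCode {L : Type*} [Field L] {N M n : ℕ} (C : Fin N → Submodule L (Fin n → L))
    (A : Matrix (Fin N) (Fin M) L) : Submodule L (Fin M × Fin n → L) where
  carrier := {x | ∃ c : Fin N → Fin n → L, (∀ l, c l ∈ C l) ∧
    ∀ p : Fin M × Fin n, x p = ∑ l, A l p.1 * c l p.2}
  add_mem' := by
    rintro x y ⟨c, hc, hx⟩ ⟨c', hc', hy⟩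
    refine ⟨c + c', fun l => (C l).add_mem (hc l) (hc' l), fun p => ?_⟩
    simp [hx, hy, mul_add, Finset.sum_add_distrib]
  zero_mem' := ⟨0, fun l => (C l).zero_mem, fun p => by simp⟩
  smul_mem' := by
    rintro a x ⟨c, hc, hx⟩
    refine ⟨a • c, fun l => (C l).smul_mem a (hc l), fun p => ?_⟩
    simp [hx, Finset.mul_sum, mul_left_comm]

/-- `D_i(A)`: the minimum distance of the code generated by the first `i` rows of `A`. -/
noncomputable def rowDist {L : Type*} [Field L] {N M : ℕ} (A : Matrix (Fin N) (Fin M) L)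
    (i : ℕ) : ℕ∞ :=
  minDist (Submodule.span L ((fun l => A l) '' {l : Fin N | (l : ℕ) < i}))

/-- For every `i`, `τ i` is the least column index `s ∉ {τ 1, …, τ (i-1)}` for which the minor of
`B` on the rows `1, …, i` and the columns `τ 1, …, τ (i-1), s` is nonzero. (The columns are taken
in this order; sorting them changes the minor at most by a sign. For the first row the condition
says that `τ 1` is the position of the first nonzero entry of that row.) -/
def IsMinorPerm {L : Type*} [Field L] {N : ℕ} (B : Matrix (Fin N) (Fin N) L)
    (τ : Equiv.Perm (Fin N)) : Prop :=
  ∀ i : Fin N, IsLeast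
    {s : Fin N | (∀ j < i, τ j ≠ s) ∧
      (B.submatrix (fun j : Set.Iic i => (j : Fin N))
        (fun j : Set.Iic i => if (j : Fin N) < i then τ j else s)).det ≠ 0}
    (τ i)

/-! ### Locally repairable codes -/

/-- The punctured code `C|_S`: the restrictions of the codewords to the coordinates in `S`. -/
def punctured {L ι : Type*} [Field L] (C : Submodule L (ι → L)) (S : Finset ι) :
    Submodule L (S → L) :=
  C.map (LinearMap.funLeft L L (Subtype.val : S → ι))

/-- `C` is an `(r, δ)`-LRC: every symbol has `(r, δ)`-locality. -/
def IsLRC {L ι : Type*} [Field L] [Fintype ι] (C : Submodule L (ι → L)) (r δ : ℕ) : Prop :=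
  ∀ i : ι, ∃ S : Finset ι, i ∈ S ∧ S.card ≤ r + δ - 1 ∧ (δ : ℕ∞) ≤ minDist (punctured C S)

/-- `C` is an optimal `(r, δ)`-LRC with parameters `[n, k, d]`: it meets the Singleton-type bound
with equality. -/
structure IsOptimalLRC {L ι : Type*} [Field L] [Fintype ι] (C : Submodule L (ι → L))
    (r δ n k d : ℕ) : Prop where
  length : Fintype.card ι = n
  dim : Module.finrank L C = k
  dist : minDist C = d
  lrc : IsLRC C r δ
  optimal : (d : ℤ) = n - k + 1 - (⌈(k : ℚ) / r⌉ - 1) * ((δ : ℤ) - 1)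

/-! ### Quantum codes

The Hilbert space `(ℂ ^ q)^{⊗ ι} ≅ ℂ ^ (q ^ |ι|)` has an orthonormal basis `|x⟩` indexed by the
vectors `x ∈ F ^ ι`, where `|F| = q`; its elements are the functions `(ι → F) → ℂ`. -/

/-- The error operator `X(a) Z(b)`, which maps `|x⟩` to `ψ (b ⬝ x) |x + a⟩`; here `e = (a, b)` and
`ψ` is a nontrivial additive character of `F`. -/
def errorOp {F ι : Type*} [Field F] [Fintype ι] (ψ : AddChar F ℂ) (e : (ι → F) × (ι → F)) :
    ((ι → F) → ℂ) →ₗ[ℂ] ((ι → F) → ℂ) where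
  toFun v := fun x => ψ (∑ i, e.2 i * (x i - e.1 i)) * v (x - e.1)
  map_add' := by intro v w; funext x; simp [mul_add]
  map_smul' := by intro c v; funext x; simp [mul_left_comm]

open Classical in
/-- The weight of the error `X(a) Z(b)`: the number of positions on which it acts nontrivially. -/
noncomputable def errorWeight {F ι : Type*} [Field F] [Fintype ι] (e : (ι → F) × (ι → F)) : ℕ :=
  (Finset.univ.filter (fun i : ι => e.1 i ≠ 0 ∨ e.2 i ≠ 0)).card

/-- `Q` is a `q`-ary quantum code of length `n`, dimension `q ^ k` and distance (at least) `d`,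
`q = |F|`: it detects every error of weight less than `d`, that is, `P E P` is a scalar multiple
of `P`, where `P` is the orthogonal projection onto `Q`. -/
structure IsQuantumCode {F ι : Type*} [Field F] [Fintype F] [Fintype ι] [DecidableEq ι]
    (ψ : AddChar F ℂ) (Q : Submodule ℂ ((ι → F) → ℂ)) (n k d : ℕ) : Prop where
  length : Fintype.card ι = n
  dim : Module.finrank ℂ Q = Fintype.card F ^ k
  detects : ∀ e : (ι → F) × (ι → F), errorWeight e < d →
    ∃ c : ℂ, ∀ u ∈ Q, ∀ v ∈ Q,
      ∑ x, star (u x) * errorOp ψ e v x = c * ∑ x, star (u x) * v x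

/-- `Q` is a stabilizer code for the set `S` of errors: a nonzero joint eigenspace of the operators
`X(a) Z(b)`, `(a, b) ∈ S`; equivalently, the nonzero common fixed space of suitable scalar
multiples of them. -/
def IsStabilizerCode {F ι : Type*} [Field F] [Fintype ι] (ψ : AddChar F ℂ)
    (S : Set ((ι → F) × (ι → F))) (Q : Submodule ℂ ((ι → F) → ℂ)) : Prop :=
  Q ≠ ⊥ ∧ ∃ χ : (ι → F) × (ι → F) → ℂ, ∀ v, v ∈ Q ↔ ∀ e ∈ S, errorOp ψ e v = χ e • v

/-- `Q` is a quantum code induced by the code `C` over `F` through the Euclidean dual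
(CSS construction): the stabilizer consists of the `X(a) Z(b)` with `a, b` in the dual of `C`. -/
def IsInducedEuclidean {F ι : Type*} [Field F] [Fintype ι] (ψ : AddChar F ℂ)
    (C : Submodule F (ι → F)) (Q : Submodule ℂ ((ι → F) → ℂ)) : Prop :=
  IsStabilizerCode ψ {e | e.1 ∈ euclideanDual C ∧ e.2 ∈ euclideanDual C} Q

/-- `Q` is a quantum code induced by the code `C` over `K`, `|K| = |F| ^ 2`, through the Hermitian
dual: for a basis `β, γ` of `K` over `F`, the stabilizer consists of the `X(a) Z(b)` with
`β a + γ b` in the Hermitian dual of `C`. -/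
def IsInducedHermitian {F K ι : Type*} [Field F] [Fintype F] [Field K] [Algebra F K] [Fintype ι]
    (ψ : AddChar F ℂ) (C : Submodule K (ι → K)) (Q : Submodule ℂ ((ι → F) → ℂ)) : Prop :=
  ∃ β : Module.Basis (Fin 2) F K,
    IsStabilizerCode ψ
      {e | (fun i => e.1 i • β 0 + e.2 i • β 1) ∈ hermitianDual (Fintype.card F) C} Q

/-- The conditions under which a linear code `C` with dual `C'` (Euclidean or Hermitian), with
induced quantum codes described by `IsInduced`, induces an optimal quantum `(r, δ)`-LRC with
parameters `[[n, k, d]]`. Here `d` is the minimum distance of `C`. -/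
structure InducesOptimalQLRC {F L ι : Type*} [Field F] [Fintype F] [Field L] [Fintype ι]
    [DecidableEq ι] (ψ : AddChar F ℂ) (C C' : Submodule L (ι → L))
    (IsInduced : Submodule ℂ ((ι → F) → ℂ) → Prop) (r δ n k d : ℕ) : Prop where
  length : Fintype.card ι = n
  dual_le : C' ≤ C
  dim : 2 * Module.finrank L C = n + k
  lrc : IsLRC C r δ
  le_dual : (δ : ℕ∞) ≤ minDist C'
  dist : minDist C = d
  /-- There is an induced quantum code, and every one has parameters `[[n, k, ≥ d]]`. -/
  exists_code : ∃ Q, IsInduced Q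
  parameters : ∀ Q, IsInduced Q → IsQuantumCode ψ Q n k d
  optimal : (k : ℤ) + 2 * d + 2 * (⌈((n : ℚ) + k) / (2 * r)⌉ - 1) * ((δ : ℤ) - 1) = n + 2

/-- The code `C` over `F` induces an optimal quantum `(r, δ)`-LRC `[[n, k, d]]_q`, `q = |F|`, through
its Euclidean dual. -/
def InducesEuclidean {F ι : Type*} [Field F] [Fintype F] [Fintype ι] [DecidableEq ι]
    (ψ : AddChar F ℂ) (C : Submodule F (ι → F)) (r δ n k d : ℕ) : Prop :=
  InducesOptimalQLRC ψ C (euclideanDual C) (IsInducedEuclidean ψ C) r δ n k d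

/-- The code `C` over `K`, `|K| = |F| ^ 2`, induces an optimal quantum `(r, δ)`-LRC `[[n, k, d]]_q`,
`q = |F|`, through its Hermitian dual. -/
def InducesHermitian {F K ι : Type*} [Field F] [Fintype F] [Field K] [Algebra F K] [Fintype ι]
    [DecidableEq ι] (ψ : AddChar F ℂ) (C : Submodule K (ι → K)) (r δ n k d : ℕ) : Prop :=
  InducesOptimalQLRC ψ C (hermitianDual (Fintype.card F) C) (IsInducedHermitian ψ C) r δ n k d

/-! ### The two cases of the characterization

The codes `C_1, …, C_N` are indexed by `Fin N`, so that `C_1` has index `0` and `C_N` has index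
`N - 1`. -/

/-- Case I: `D_{N-1}(A) = 1`, `C_1 = … = C_N`, all `d_i = δ`, and `⌈N k_1 / r⌉ = N ⌈k_1 / r⌉`. -/
def CaseI {L : Type*} [Field L] {N n : ℕ} (hN : 2 ≤ N) (C : Fin N → Submodule L (Fin n → L))
    (A : Matrix (Fin N) (Fin N) L) (r δ : ℕ) (k d : Fin N → ℕ) : Prop :=
  rowDist A (N - 1) = 1 ∧
  (∀ i j, C i = C j) ∧ (∀ i, d i = δ) ∧
  ⌈((N : ℚ) * k ⟨0, by omega⟩) / r⌉ = N * ⌈(k ⟨0, by omega⟩ : ℚ) / r⌉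

/-- Case II: `D_{N-1}(A) = 2`, `C_1 = … = C_{N-1}`, `d_1 = … = d_{N-1} = δ`, `d_N ≤ 2 δ`, and
`⌈((N - 1) k_1 + k_N) / r⌉ = (N - 1) ⌈k_1 / r⌉ + ⌈k_N / r⌉`. -/
def CaseII {L : Type*} [Field L] {N n : ℕ} (hN : 2 ≤ N) (C : Fin N → Submodule L (Fin n → L))
    (A : Matrix (Fin N) (Fin N) L) (r δ : ℕ) (k d : Fin N → ℕ) : Prop :=
  rowDist A (N - 1) = 2 ∧
  (∀ i j : Fin N, (i : ℕ) < N - 1 → (j : ℕ) < N - 1 → C i = C j) ∧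
  (∀ i : Fin N, (i : ℕ) < N - 1 → d i = δ) ∧ d ⟨N - 1, by omega⟩ ≤ 2 * δ ∧
  ⌈(((N : ℚ) - 1) * k ⟨0, by omega⟩ + k ⟨N - 1, by omega⟩) / r⌉ =
    ((N : ℤ) - 1) * ⌈(k ⟨0, by omega⟩ : ℚ) / r⌉ + ⌈(k ⟨N - 1, by omega⟩ : ℚ) / r⌉

/-!
Let `k = ∑ k_l` be the dimension of `C(A)` (`finrank_mpCode`). The distance of `C(A)` is
`min_l d_l D_l(A)`, where `D_l(A)` is the distance of the code spanned by the first `l` rows of `A`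
(`le_minDist_mpCode`, `minDist_mpCode_le`); in particular it is at most `d_N`, as `D_N(A) = 1`.
Since every block of a codeword lies in `C_1`, the code `C(A)` is always an `(r, δ)`-LRC
(`IsLRC.mpCode`). Inserting the Singleton-type equalities
for the `C_l`, optimality of `C(A)` becomes
`∑ (d_l - δ) + (δ - d(C(A))) + (δ - 1) (∑ ⌈k_l / r⌉ - ⌈k / r⌉) = 0`.
As `d_l ≥ δ` and `d(C(A)) ≤ d_N`, this holds exactly if `d_l = δ` for `l < N`, `d(C(A)) = d_N` and
the ceilings add up (`optimal_iff_of_dist_le`). The first condition forces `C_1 = … = C_{N-1}`, and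
the second then says `d_N ≤ δ D_{N-1}(A)`. The first `N - 1` rows of `A` span a hyperplane, so that
`D_{N-1}(A)` is `1` or `2`; these are the two cases (`caseI_or_caseII_iff`).

For the inclusion `C(A)^⊥ ⊆ C(A)` (`sesqDual_mpCode_le`), the condition on `τ` provides a
factorization of `B` into a lower triangular matrix and one whose row `i` starts in column `τ i`.
The components of an element of `C(A)^⊥` are obtained from elements of `C_l^⊥` by applying the
inverse transpose of `B`, and the triangular shapes combine with the nesting of the codes and with
`C_{τ i}^⊥ ⊆ C_i`. Both dualities are treated at once, with respect to an involution `σ` of the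
field.

The quantum codes are handled by the standard stabilizer argument. The error operators of the
stabilizer commute, hence have a common eigenvector (`exists_isStabilizerCode`); a common eigenspace
has the dimension `q ^ m / |S|`, by the trace of the projection onto it
(`IsStabilizerCode.finrank_mul_card`); and an error of weight below `d(C)` commuting with the
stabilizer corresponds to a word of the bidual `C`, so that it is trivial (`inducedEuclidean`,
`inducedHermitian`).
-/

/-! ### Minimum distance -/

open Classical in
theorem le_minDist_iff {L ι : Type*} [Field L] [Fintype ι] {C : Submodule L (ι → L)} {m : ℕ∞} :
    m ≤ minDist C ↔ ∀ x ∈ C, x ≠ 0 → m ≤ (hammingNorm x : ℕ∞) := by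
  simp only [minDist, le_iInf_iff]

open Classical in
theorem minDist_le {L ι : Type*} [Field L] [Fintype ι] {C : Submodule L (ι → L)} {x : ι → L}
    (hx : x ∈ C) (h0 : x ≠ 0) : minDist C ≤ (hammingNorm x : ℕ∞) :=
  le_minDist_iff.1 le_rfl x hx h0

theorem minDist_anti {L ι : Type*} [Field L] [Fintype ι] {C D : Submodule L (ι → L)} (h : C ≤ D) :
    minDist D ≤ minDist C :=
  le_minDist_iff.2 fun _ hx h0 => minDist_le (h hx) h0

theorem one_le_minDist {L ι : Type*} [Field L] [Fintype ι] (C : Submodule L (ι → L)) :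
    1 ≤ minDist C := by
  classical
  refine le_minDist_iff.2 fun x _ h0 => ?_
  exact_mod_cast hammingNorm_pos_iff.2 h0

open Classical in
theorem exists_hammingNorm_eq {L ι : Type*} [Field L] [Fintype ι] {C : Submodule L (ι → L)}
    (h : minDist C ≠ ⊤) : ∃ x ∈ C, x ≠ 0 ∧ (hammingNorm x : ℕ∞) = minDist C := by
  by_contra! hne
  have key : minDist C + 1 ≤ minDist C := le_minDist_iff.2 fun x hx h0 =>
    Order.add_one_le_of_lt (lt_of_le_of_ne (minDist_le hx h0) (hne x hx h0).symm)
  exact absurd key (not_le.2 ((ENat.lt_add_one_iff h).2 le_rfl))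

/-! ### Dual codes -/

/-- The dual of a code with respect to the form `(x, y) ↦ ∑ x_i σ(y_i)`. The Euclidean dual is the
case `σ = id`, the Hermitian dual the case of the Frobenius map `σ(y) = y ^ q`. -/
def sesqDual {L ι : Type*} [Field L] [Fintype ι] (σ : L →+* L) (C : Submodule L (ι → L)) :
    Submodule L (ι → L) where
  carrier := {x | ∀ y ∈ C, ∑ i, x i * σ (y i) = 0}
  add_mem' := by
    intro x x' hx hx' y hy
    simp [add_mul, Finset.sum_add_distrib, hx y hy, hx' y hy]
  zero_mem' := by intro y _; simp
  smul_mem' := by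
    intro c x hx y hy
    simp [mul_assoc, ← Finset.mul_sum, hx y hy]

theorem sesqDual_anti {L ι : Type*} [Field L] [Fintype ι] {σ : L →+* L}
    {C D : Submodule L (ι → L)} (h : C ≤ D) : sesqDual σ D ≤ sesqDual σ C :=
  fun _ hx y hy => hx y (h hy)

theorem finrank_euclideanDual {L ι : Type*} [Field L] [Fintype ι] (C : Submodule L (ι → L)) :
    Module.finrank L (euclideanDual C) + Module.finrank L C = Fintype.card ι := by
  classical
  have hB : (dotProductBilin L L : LinearMap.BilinForm L (ι → L)).Nondegenerate := by
    refine ⟨fun x hx => dotProduct_eq_zero x fun w => hx w,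
      fun x hx => dotProduct_eq_zero x fun w => ?_⟩
    rw [dotProduct_comm]; exact hx w
  have h := LinearMap.BilinForm.finrank_orthogonal hB C
  have he : LinearMap.BilinForm.orthogonal (dotProductBilin L L) C = euclideanDual C := by
    ext x
    simp only [LinearMap.BilinForm.mem_orthogonal_iff]
    refine forall₂_congr fun y _ => ?_
    change y ⬝ᵥ x = 0 ↔ x ⬝ᵥ y = 0
    rw [dotProduct_comm]
  have hle := Submodule.finrank_le C
  rw [he, Module.finrank_pi] at h
  rw [Module.finrank_pi] at hle
  omega

/-- Conjugation of the coordinates is a bijection between the two duals. Over a finite field the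
dimensions can be compared by counting, although the bijection is only semilinear. -/
theorem finrank_sesqDual {L ι : Type*} [Field L] [Finite L] [Fintype ι] {σ : L →+* L}
    (hσ : ∀ x, σ (σ x) = x) (C : Submodule L (ι → L)) :
    Module.finrank L (sesqDual σ C) + Module.finrank L C = Fintype.card ι := by
  rw [← finrank_euclideanDual C]
  congr 1
  have hmem : ∀ x : ι → L, x ∈ sesqDual σ C ↔ (fun i => σ (x i)) ∈ euclideanDual C := by
    intro x
    refine forall₂_congr fun y _ => ?_
    rw [← map_eq_zero_iff σ σ.injective]
    simp [hσ]
  have hcard : Nat.card (sesqDual σ C) = Nat.card (euclideanDual C) := by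
    refine Nat.card_congr
      ⟨fun x => ⟨fun i => σ (x.1 i), (hmem _).1 x.2⟩,
        fun x => ⟨fun i => σ (x.1 i), (hmem _).2 (by simp [hσ])⟩, ?_, ?_⟩ <;>
    · intro x; ext i; simp [hσ]
  rw [Module.natCard_eq_pow_finrank (K := L) (V := sesqDual σ C),
    Module.natCard_eq_pow_finrank (K := L) (V := euclideanDual C)] at hcard
  exact Nat.pow_right_injective Finite.one_lt_card hcard

theorem sum_mul_map_comm {L ι : Type*} [Field L] [Fintype ι] {σ : L →+* L}
    (hσ : ∀ x, σ (σ x) = x) (x y : ι → L) :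
    σ (∑ i, x i * σ (y i)) = ∑ i, y i * σ (x i) := by
  simp [hσ, mul_comm]

theorem sesqDual_sesqDual {L ι : Type*} [Field L] [Finite L] [Fintype ι] {σ : L →+* L}
    (hσ : ∀ x, σ (σ x) = x) (C : Submodule L (ι → L)) : sesqDual σ (sesqDual σ C) = C := by
  symm
  apply Submodule.eq_of_le_of_finrank_eq
  · intro x hx y hy
    rw [← sum_mul_map_comm hσ, hy x hx, map_zero]
  · have h1 := finrank_sesqDual hσ C
    have h2 := finrank_sesqDual hσ (sesqDual σ C)
    omega

/-- A code containing its dual has at least half the dimension of the ambient space. -/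
theorem exists_two_mul_finrank_eq {L ι : Type*} [Field L] [Finite L] [Fintype ι] {σ : L →+* L}
    (hσ : ∀ x, σ (σ x) = x) {C : Submodule L (ι → L)} (h : sesqDual σ C ≤ C) :
    ∃ k, 2 * Module.finrank L C = Fintype.card ι + k := by
  have h1 := finrank_sesqDual hσ C
  have h2 := Submodule.finrank_mono h
  exact ⟨2 * Module.finrank L C - Fintype.card ι, by omega⟩

/-! ### Dimension, locality and distance of matrix-product codes -/

open Classical in
/-- A locally repairable code has distance at least `δ`: a nonzero codeword already has weight `δ`
on a recovery set of any coordinate of its support. -/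
theorem IsLRC.le_minDist {L ι : Type*} [Field L] [Fintype ι] {C : Submodule L (ι → L)} {r δ : ℕ}
    (h : IsLRC C r δ) : (δ : ℕ∞) ≤ minDist C := by
  refine le_minDist_iff.2 fun x hx h0 => ?_
  obtain ⟨i, hi⟩ := Function.ne_iff.1 h0
  obtain ⟨S, hiS, -, hS⟩ := h i
  refine (le_minDist_iff.1 hS (fun s => x s) ⟨x, hx, rfl⟩
    (Function.ne_iff.2 ⟨⟨i, hiS⟩, hi⟩)).trans ?_
  exact_mod_cast Finset.card_le_card_of_injOn Subtype.val (by intro; simp) (by simp)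

/-- Every block of a codeword lies in the largest of the codes, so that the recovery sets of that
code serve in each block. -/
theorem IsLRC.mpCode {L : Type*} [Field L] {N M n : ℕ} {C : Fin N → Submodule L (Fin n → L)}
    {A : Matrix (Fin N) (Fin M) L} {r δ : ℕ} {l₀ : Fin N} (h : IsLRC (C l₀) r δ)
    (hC : ∀ l, C l ≤ C l₀) : IsLRC (mpCode C A) r δ := by
  classical
  rintro ⟨j, i⟩
  obtain ⟨S, hiS, hcard, hS⟩ := h i
  let f : Fin n ↪ Fin M × Fin n := ⟨fun s => (j, s), fun a b hab => (Prod.mk.inj hab).2⟩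
  refine ⟨S.map f, Finset.mem_map_of_mem f hiS, by rwa [Finset.card_map], ?_⟩
  refine le_minDist_iff.2 ?_
  rintro _ ⟨x, ⟨c, hc, hx⟩, rfl⟩ h0
  have hy : (fun s => x (j, s)) ∈ C l₀ := by
    have : (fun s => x (j, s)) = ∑ l, A l j • c l := by
      ext s; simp [hx]
    rw [this]
    exact Submodule.sum_mem _ fun l _ => Submodule.smul_mem _ _ (hC l (hc l))
  refine (le_minDist_iff.1 hS (fun s => x (j, s)) ⟨_, hy, rfl⟩ ?_).trans ?_
  · obtain ⟨⟨p, hp⟩, hne⟩ := Function.ne_iff.1 h0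
    obtain ⟨s, hs, rfl⟩ := Finset.mem_map.1 hp
    exact Function.ne_iff.2 ⟨⟨s, hs⟩, hne⟩
  · refine Nat.cast_le.2 (Finset.card_le_card_of_injOn
      (fun s : S => (⟨f s, Finset.mem_map_of_mem f s.2⟩ : S.map f)) ?_ ?_)
    · intro s hs
      simp only [Finset.coe_filter, Finset.mem_univ, true_and, Set.mem_ofPred_eq] at hs ⊢
      exact hs
    · intro a _ b _ hab
      exact Subtype.ext (f.injective (congrArg Subtype.val hab))

theorem finrank_mpCode {L : Type*} [Field L] {N n : ℕ} (C : Fin N → Submodule L (Fin n → L))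
    {A : Matrix (Fin N) (Fin N) L} (hA : IsUnit A) :
    Module.finrank L (mpCode C A) = ∑ l, Module.finrank L (C l) := by
  let Φ : (∀ l, C l) →ₗ[L] (Fin N × Fin n → L) :=
    { toFun := fun c p => ∑ l, A l p.1 * (c l : Fin n → L) p.2
      map_add' := by intro c c'; ext p; simp [mul_add, Finset.sum_add_distrib]
      map_smul' := by intro a c; ext p; simp [Finset.mul_sum, mul_left_comm] }
  have hrange : LinearMap.range Φ = mpCode C A := by
    ext x
    constructor
    · rintro ⟨c, rfl⟩
      exact ⟨fun l => c l, fun l => (c l).2, fun p => rfl⟩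
    · rintro ⟨c, hc, hx⟩
      exact ⟨fun l => ⟨c l, hc l⟩, (funext hx).symm⟩
  have hinj : Function.Injective Φ := by
    intro c c' h
    ext l i
    have : (fun l => (c l : Fin n → L) i) = fun l => (c' l : Fin n → L) i := by
      apply Matrix.vecMul_injective_of_isUnit hA
      ext j
      have := congrFun h (j, i)
      simpa [Φ, Matrix.vecMul, dotProduct, mul_comm] using this
    exact congrFun this l
  rw [← hrange, LinearMap.finrank_range_of_inj hinj, Module.finrank_pi_fintype]

theorem mem_span_rows_iff {L : Type*} [Field L] {N M : ℕ} {A : Matrix (Fin N) (Fin M) L} {i : ℕ}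
    {v : Fin M → L} :
    v ∈ Submodule.span L ((fun l => A l) '' {l : Fin N | (l : ℕ) < i}) ↔
      ∃ w : Fin N → L, (∀ l : Fin N, i ≤ l → w l = 0) ∧ Matrix.vecMul w A = v := by
  constructor
  · intro hv
    induction hv using Submodule.span_induction with
    | mem x hx =>
      obtain ⟨l, hl, rfl⟩ := hx
      refine ⟨Pi.single l 1, fun l' hl' => Pi.single_eq_of_ne ?_ _, Matrix.single_one_vecMul _ _⟩
      rintro rfl
      exact absurd hl (not_lt.2 hl')
    | zero => exact ⟨0, by simp, by simp⟩
    | add x y _ _ hx hy =>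
      obtain ⟨w, hw, rfl⟩ := hx
      obtain ⟨w', hw', rfl⟩ := hy
      exact ⟨w + w', fun l hl => by simp [hw l hl, hw' l hl], Matrix.add_vecMul _ _ _⟩
    | smul a x _ hx =>
      obtain ⟨w, hw, rfl⟩ := hx
      exact ⟨a • w, fun l hl => by simp [hw l hl], Matrix.smul_vecMul _ _ _⟩
  · rintro ⟨w, hw, rfl⟩
    rw [Matrix.vecMul_eq_sum]
    refine Submodule.sum_mem _ fun l _ => ?_
    by_cases hl : (l : ℕ) < i
    · exact Submodule.smul_mem _ _ (Submodule.subset_span ⟨l, hl, rfl⟩)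
    · simp [hw l (not_lt.1 hl)]

theorem rowDist_anti {L : Type*} [Field L] {N M : ℕ} (A : Matrix (Fin N) (Fin M) L) {i j : ℕ}
    (h : i ≤ j) : rowDist A j ≤ rowDist A i :=
  minDist_anti (Submodule.span_mono (Set.image_mono fun _ hl => lt_of_lt_of_le hl h))

theorem rowDist_self {L : Type*} [Field L] {N : ℕ} (hN : 0 < N) {A : Matrix (Fin N) (Fin N) L}
    (hA : IsUnit A) : rowDist A N = 1 := by
  classical
  refine le_antisymm ?_ (one_le_minDist _)
  obtain ⟨w, hw⟩ := Matrix.vecMul_surjective_iff_isUnit.2 hA (Pi.single ⟨0, hN⟩ 1)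
  refine (minDist_le (mem_span_rows_iff.2 ⟨w, fun l hl => absurd l.2 (not_lt.2 hl), hw⟩)
    (by simp)).trans ?_
  have : hammingNorm (Pi.single ⟨0, hN⟩ 1 : Fin N → L) ≤ 1 := by
    refine (Finset.card_le_card (t := {⟨0, hN⟩}) fun j hj => ?_).trans (by simp)
    by_contra hj'
    simp only [Finset.mem_singleton] at hj'
    simp [hj'] at hj
  exact_mod_cast this

/-- The first `N - 1` rows of an invertible matrix span a hyperplane, which meets every coordinate
plane. -/
theorem rowDist_pred_le_two {L : Type*} [Field L] {N : ℕ} (hN : 2 ≤ N)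
    {A : Matrix (Fin N) (Fin N) L} (hA : IsUnit A) : rowDist A (N - 1) ≤ 2 := by
  classical
  let j₀ : Fin N := ⟨0, by omega⟩
  let j₁ : Fin N := ⟨1, by omega⟩
  let l : Fin N := ⟨N - 1, by omega⟩
  have hj : j₁ ≠ j₀ := by simp [j₀, j₁]
  obtain ⟨w₀, hw₀⟩ := Matrix.vecMul_surjective_iff_isUnit.2 hA (Pi.single j₀ 1)
  obtain ⟨w₁, hw₁⟩ := Matrix.vecMul_surjective_iff_isUnit.2 hA (Pi.single j₁ 1)
  dsimp only at hw₀ hw₁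
  -- The last coordinate, in terms of the rows of `A`, is a functional vanishing on the hyperplane.
  have key : ∀ a b : L, a * w₀ l + b * w₁ l = 0 → (a ≠ 0 ∨ b ≠ 0) → rowDist A (N - 1) ≤ 2 := by
    intro a b hab hne
    have hval : Matrix.vecMul (a • w₀ + b • w₁) A = a • Pi.single j₀ 1 + b • Pi.single j₁ 1 := by
      rw [Matrix.add_vecMul, Matrix.smul_vecMul, Matrix.smul_vecMul, hw₀, hw₁]
    refine (minDist_le (mem_span_rows_iff.2 ⟨_, fun l' hl' => ?_, hval⟩) ?_).trans ?_
    · obtain rfl : l' = l := Fin.ext (by have := l'.2; simp only [l]; omega)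
      simpa using hab
    · rcases hne with h | h
      · exact Function.ne_iff.2 ⟨j₀, by simpa [hj.symm] using h⟩
      · exact Function.ne_iff.2 ⟨j₁, by simpa [hj] using h⟩
    · have : hammingNorm (a • Pi.single j₀ 1 + b • Pi.single j₁ 1 : Fin N → L) ≤ 2 := by
        refine (Finset.card_le_card (t := {j₀, j₁}) fun j hj => ?_).trans Finset.card_le_two
        by_contra hj'
        simp only [Finset.mem_insert, Finset.mem_singleton, not_or] at hj'
        simp [hj'.1, hj'.2] at hj
      exact_mod_cast this
  by_cases h : w₀ l = 0
  · exact key 1 0 (by simp [h]) (by simp)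
  · exact key (w₁ l) (-w₀ l) (by ring) (by simp [h])

theorem hammingNorm_prod {L κ ι : Type*} [Zero L] [DecidableEq L] [Fintype κ] [Fintype ι]
    (x : κ × ι → L) : hammingNorm x = ∑ i, hammingNorm fun j => x (j, i) := by
  simp only [hammingNorm, Finset.card_filter]
  rw [Fintype.sum_prod_type_right]

/-- Let `c_l` be the last nonzero component of a codeword. At each coordinate of the support of
`c_l` the codeword has a column in the span of the first `l` rows of `A`, nonzero because the rows
are independent. -/
theorem le_minDist_mpCode {L : Type*} [Field L] {N n : ℕ} {C : Fin N → Submodule L (Fin n → L)}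
    {A : Matrix (Fin N) (Fin N) L} (hA : IsUnit A) {m : ℕ∞}
    (h : ∀ l : Fin N, m ≤ minDist (C l) * rowDist A (l + 1)) : m ≤ minDist (mpCode C A) := by
  classical
  refine le_minDist_iff.2 ?_
  rintro x ⟨c, hc, hx⟩ h0
  have hne : (Finset.univ.filter fun l => c l ≠ 0).Nonempty := by
    by_contra hemp
    rw [Finset.not_nonempty_iff_eq_empty, Finset.filter_eq_empty_iff] at hemp
    refine h0 (funext fun p => ?_)
    have : ∀ l, c l = 0 := fun l => by simpa using hemp (Finset.mem_univ l)
    simp [hx, this]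
  obtain ⟨l, hl, hmax⟩ := Finset.exists_max_image _ id hne
  have hl0 : c l ≠ 0 := (Finset.mem_filter.1 hl).2
  have hzero : ∀ l', l < l' → c l' = 0 := by
    intro l' hlt
    by_contra hc'
    exact absurd (hmax l' (by simp [hc'])) (not_le.2 hlt)
  have hcol : ∀ i, c l i ≠ 0 → rowDist A (l + 1) ≤ (hammingNorm fun j => x (j, i) : ℕ) := by
    intro i hi
    have hval : Matrix.vecMul (fun l => c l i) A = fun j => x (j, i) := by
      ext j; simp [hx, Matrix.vecMul, dotProduct, mul_comm]
    refine minDist_le (mem_span_rows_iff.2 ⟨fun l => c l i, fun l' hl' => ?_, hval⟩) ?_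
    · simp [hzero l' (Fin.lt_def.2 (by omega))]
    · rw [← hval]
      intro h
      refine hi (congrFun
        (Matrix.vecMul_injective_of_isUnit hA (a₁ := fun l => c l i) (a₂ := 0) ?_) l)
      simpa using h
  calc m ≤ minDist (C l) * rowDist A (l + 1) := h l
    _ ≤ (hammingNorm (c l) : ℕ∞) * rowDist A (l + 1) := by
        gcongr
        exact minDist_le (hc l) hl0
    _ = ∑ i ∈ Finset.univ.filter (fun i => c l i ≠ 0), rowDist A (l + 1) := by
        simp [hammingNorm]
    _ ≤ ∑ i ∈ Finset.univ.filter (fun i => c l i ≠ 0), ((hammingNorm fun j => x (j, i) : ℕ) : ℕ∞) :=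
        Finset.sum_le_sum fun i hi => hcol i (Finset.mem_filter.1 hi).2
    _ ≤ ∑ i, ((hammingNorm fun j => x (j, i) : ℕ) : ℕ∞) :=
        Finset.sum_le_sum_of_subset (Finset.filter_subset _ _)
    _ = (hammingNorm x : ℕ∞) := by rw [hammingNorm_prod, Nat.cast_sum]

/-- For nested codes, a word of minimum weight of `C_l` and a vector of minimum weight in the span
of the first `l` rows of `A` have their tensor product in the matrix-product code. -/
theorem minDist_mpCode_le {L : Type*} [Field L] {N M n : ℕ} {C : Fin N → Submodule L (Fin n → L)}
    {A : Matrix (Fin N) (Fin M) L} (hC : Antitone C) (l : Fin N) :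
    minDist (mpCode C A) ≤ minDist (C l) * rowDist A (l + 1) := by
  classical
  by_cases h₁ : minDist (C l) = ⊤
  · rw [h₁, rowDist, ENat.top_mul (zero_lt_one.trans_le (one_le_minDist _)).ne']
    exact le_top
  by_cases h₂ : rowDist A (l + 1) = ⊤
  · rw [h₂, ENat.mul_top (zero_lt_one.trans_le (one_le_minDist _)).ne']
    exact le_top
  obtain ⟨c, hc, hc0, hcw⟩ := exists_hammingNorm_eq h₁
  obtain ⟨v, hv, hv0, hvw⟩ := exists_hammingNorm_eq h₂
  obtain ⟨w, hw, rfl⟩ := mem_span_rows_iff.1 hv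
  set v := Matrix.vecMul w A
  have hmem : (fun p : Fin M × Fin n => v p.1 * c p.2) ∈ mpCode C A := by
    refine ⟨fun l' => w l' • c, fun l' => ?_, fun p => ?_⟩
    · by_cases hl' : l' ≤ l
      · exact Submodule.smul_mem _ _ (hC hl' hc)
      · have : w l' = 0 := hw l' (Nat.succ_le_of_lt (not_le.1 hl'))
        simp only [this, zero_smul]
        exact Submodule.zero_mem _
    · simp only [v, Matrix.vecMul, dotProduct, Finset.sum_mul, Pi.smul_apply, smul_eq_mul]
      exact Finset.sum_congr rfl fun _ _ => by ring
  obtain ⟨i, hi⟩ := Function.ne_iff.1 hc0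
  obtain ⟨j, hj⟩ := Function.ne_iff.1 hv0
  refine (minDist_le hmem (Function.ne_iff.2 ⟨(j, i), mul_ne_zero hj hi⟩)).trans ?_
  rw [← hcw, rowDist, ← hvw]
  norm_cast
  simp only [hammingNorm]
  rw [mul_comm, ← Finset.card_product]
  refine Finset.card_le_card fun p hp => ?_
  simpa using hp

/-! ### The dual of a matrix-product code -/

/-- Row reduction without row exchanges. The rows of `Λ` are rows of adjugates of the minors in
`IsMinorPerm`, so that by Cramer's rule the entries of `Λ * B` are the minors themselves. -/
theorem IsMinorPerm.exists_lowerTriangular {L : Type*} [Field L] {N : ℕ}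
    {B : Matrix (Fin N) (Fin N) L} {τ : Equiv.Perm (Fin N)} (hτ : IsMinorPerm B τ) :
    ∃ Λ : Matrix (Fin N) (Fin N) L, (∀ i j, i < j → Λ i j = 0) ∧
      (∀ i s, s < τ i → (Λ * B) i s = 0) ∧ ∀ i, (Λ * B) i (τ i) ≠ 0 := by
  let M (i s : Fin N) : Matrix (Set.Iic i) (Set.Iic i) L :=
    B.submatrix (fun j : Set.Iic i => (j : Fin N))
      (fun j : Set.Iic i => if (j : Fin N) < i then τ j else s)
  let Λ : Matrix (Fin N) (Fin N) L := fun i j =>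
    if h : j ≤ i then (M i (τ i)).adjugate ⟨i, Set.mem_Iic.2 le_rfl⟩ ⟨j, Set.mem_Iic.2 h⟩ else 0
  have hmul : ∀ i s, (Λ * B) i s = (M i s).det := by
    intro i s
    have hM : M i s = (M i (τ i)).updateCol ⟨i, Set.mem_Iic.2 le_rfl⟩ (fun j => B j s) := by
      ext a b
      by_cases hb : b = ⟨i, Set.mem_Iic.2 le_rfl⟩
      · subst hb; simp [M]
      · have hlt : (b : Fin N) < i := lt_of_le_of_ne b.2 fun h => hb (Subtype.ext h)
        rw [Matrix.updateCol_ne hb]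
        simp [M, hlt]
    rw [hM, ← Matrix.cramer_apply, Matrix.cramer_eq_adjugate_mulVec, Matrix.mul_apply,
      Matrix.mulVec, dotProduct]
    symm
    rw [← Finset.sum_subset (Finset.subset_univ (Finset.univ.filter fun j : Fin N => j ≤ i))]
    · refine Finset.sum_bij (fun j _ => (j : Fin N)) ?_ ?_ ?_ ?_
      · intro j _; exact Finset.mem_filter.2 ⟨Finset.mem_univ _, j.2⟩
      · intro a _ b _ hab; exact Subtype.ext hab
      · intro b hb
        exact ⟨⟨b, Set.mem_Iic.2 (Finset.mem_filter.1 hb).2⟩, Finset.mem_univ _, rfl⟩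
      · rintro ⟨j, hj⟩ _
        simp [Λ, Set.mem_Iic.1 hj]
    · intro j _ hj
      have : ¬ j ≤ i := by simpa using hj
      simp [Λ, this]
  refine ⟨Λ, fun i j hij => by simp [Λ, not_le.2 hij], fun i s hs => ?_, fun i => ?_⟩
  · rw [hmul]
    by_cases h : ∃ j < i, τ j = s
    · obtain ⟨j, hj, rfl⟩ := h
      -- The column `τ j` occurs twice.
      refine Matrix.det_zero_of_column_eq (i := ⟨j, Set.mem_Iic.2 hj.le⟩)
        (j := ⟨i, Set.mem_Iic.2 le_rfl⟩) ?_ fun a => ?_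
      · simpa using hj.ne
      · simp [M, hj]
    · push Not at h
      by_contra hdet
      exact absurd ((hτ i).2 ⟨h, hdet⟩) (not_le.2 hs)
  · rw [hmul]
    exact (hτ i).1.2

/-- The components `c_j` of an element of the dual satisfy `∑ B_{j,l} c_j ∈ C_l^⊥`, where
`B = A σ(A)ᵀ`. With `R = Λ B` as in `IsMinorPerm.exists_lowerTriangular` and `c = Λᵀ f`, this says
`Rᵀ f ∈ ∏ C_l^⊥`; as row `i` of `R` starts in column `τ i`, it follows that
`f_i ∈ C_{τ i}^⊥ ⊆ C_i`, and so `c_j ∈ C_j`. -/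
theorem sesqDual_mpCode_le {L : Type*} [Field L] {N n : ℕ} {σ : L →+* L}
    {C : Fin N → Submodule L (Fin n → L)} {A : Matrix (Fin N) (Fin N) L}
    {τ : Equiv.Perm (Fin N)} (hA : IsUnit A) (hC : Antitone C)
    (hτ : IsMinorPerm (A * A.transpose.map σ) τ) (h : ∀ i, sesqDual σ (C (τ i)) ≤ C i) :
    sesqDual σ (mpCode C A) ≤ mpCode C A := by
  intro x hx
  obtain ⟨Λ, hΛ, hR0, hRτ⟩ := hτ.exists_lowerTriangular
  set B := A * A.transpose.map σ with hB
  set R := Λ * B with hR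
  have hBunit : IsUnit B := by
    refine hA.mul ?_
    rw [Matrix.isUnit_iff_isUnit_det] at hA ⊢
    rw [← RingHom.mapMatrix_apply, ← RingHom.map_det, Matrix.det_transpose]
    exact hA.map σ
  have hRunit : IsUnit R := by
    rw [Matrix.isUnit_iff_isUnit_det, isUnit_iff_ne_zero]
    have hdet : (R.submatrix τ.symm id).det ≠ 0 := by
      rw [Matrix.det_of_isUpperTriangular]
      · refine Finset.prod_ne_zero_iff.2 fun s _ => ?_
        simpa using hRτ (τ.symm s)
      · intro s t hts
        exact hR0 _ _ (by simpa using hts)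
    rw [Matrix.det_permute] at hdet
    exact right_ne_zero_of_mul hdet
  choose c' hc' using fun i => Matrix.vecMul_surjective_iff_isUnit.2 hA (fun j => x (j, i))
  let c : Fin N → Fin n → L := fun l i => c' i l
  have hxc : ∀ p : Fin N × Fin n, x p = ∑ l, A l p.1 * c l p.2 := by
    intro p
    have := congrFun (hc' p.2) p.1
    simp only [Matrix.vecMul, dotProduct] at this
    rw [← this]
    exact Finset.sum_congr rfl fun _ _ => mul_comm _ _
  let e : Fin N → Fin n → L := fun l i => ∑ j, c j i * B j l
  have he : ∀ l, e l ∈ sesqDual σ (C l) := by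
    intro l y hy
    have hz : (fun p : Fin N × Fin n => A l p.1 * y p.2) ∈ mpCode C A := by
      refine ⟨Pi.single l y, fun l' => ?_, fun p => ?_⟩
      · by_cases hl : l' = l
        · subst hl; simpa using hy
        · simp [hl]
      · rw [Finset.sum_eq_single l]
        · simp
        · intro b _ hb; simp [hb]
        · simp
    rw [← hx _ hz, Fintype.sum_prod_type_right]
    refine Finset.sum_congr rfl fun i _ => ?_
    simp only [e, hB, Matrix.mul_apply, Matrix.map_apply, Matrix.transpose_apply, hxc, map_mul,
      Finset.sum_mul, Finset.mul_sum]
    rw [Finset.sum_comm]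
    exact Finset.sum_congr rfl fun _ _ => Finset.sum_congr rfl fun _ _ => by ring
  choose f' hf' using fun i => Matrix.vecMul_surjective_iff_isUnit.2 hRunit (fun l => e l i)
  let f : Fin N → Fin n → L := fun l i => f' i l
  have hfe : ∀ s, ∑ t, R t s • f t = e s := by
    intro s
    ext i
    have := congrFun (hf' i) s
    simp only [Matrix.vecMul, dotProduct] at this
    rw [← this]
    simp [f, mul_comm]
  have hcf : ∀ j, c j = ∑ t, Λ t j • f t := by
    intro j
    ext i
    have : c' i = Matrix.vecMul (f' i) Λ := by
      apply Matrix.vecMul_injective_of_isUnit hBunit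
      dsimp only
      rw [Matrix.vecMul_vecMul, ← hR]
      exact (hf' i).symm
    have := congrFun this j
    simp only [Matrix.vecMul, dotProduct] at this
    change c' i j = _
    rw [this]
    simp [f, mul_comm]
  have hf : ∀ s, f (τ.symm s) ∈ sesqDual σ (C s) := by
    intro s
    induction s using WellFoundedLT.induction with
    | ind s ih =>
    have hs := hfe s
    rw [← Finset.add_sum_erase _ _ (Finset.mem_univ (τ.symm s))] at hs
    have hne : R (τ.symm s) s ≠ 0 := by simpa using hRτ (τ.symm s)
    have hmem : R (τ.symm s) s • f (τ.symm s) ∈ sesqDual σ (C s) := by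
      rw [eq_sub_of_add_eq hs]
      refine Submodule.sub_mem _ (he s) (Submodule.sum_mem _ fun t ht => ?_)
      rcases lt_trichotomy (τ t) s with hlt | heq | hgt
      · have := ih (τ t) hlt
        rw [Equiv.symm_apply_apply] at this
        exact Submodule.smul_mem _ _ (sesqDual_anti (hC hlt.le) this)
      · exact absurd ((Equiv.eq_symm_apply τ).2 heq) (Finset.ne_of_mem_erase ht)
      · rw [hR0 t s hgt, zero_smul]
        exact Submodule.zero_mem _
    exact (Submodule.smul_mem_iff _ hne).1 hmem
  refine ⟨c, fun j => ?_, hxc⟩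
  rw [hcf]
  refine Submodule.sum_mem _ fun t _ => ?_
  by_cases htj : t < j
  · rw [hΛ t j htj, zero_smul]
    exact Submodule.zero_mem _
  · refine Submodule.smul_mem _ _ (hC (not_lt.1 htj) (h t ?_))
    simpa using hf (τ t)

/-! ### Stabilizer codes -/

/-- The symplectic form on errors: `X(a) Z(b)` and `X(a') Z(b')` commute up to the factor
`ψ (b ⬝ a' - b' ⬝ a)`. -/
def errorForm {F ι : Type*} [Field F] [Fintype ι] (e e' : (ι → F) × (ι → F)) : F :=
  ∑ i, e.2 i * e'.1 i - ∑ i, e'.2 i * e.1 i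

theorem errorOp_apply {F ι : Type*} [Field F] [Fintype ι] (ψ : AddChar F ℂ)
    (e : (ι → F) × (ι → F)) (v : (ι → F) → ℂ) (x : ι → F) :
    errorOp ψ e v x = ψ (∑ i, e.2 i * (x i - e.1 i)) * v (x - e.1) := rfl

theorem errorOp_zero {F ι : Type*} [Field F] [Fintype ι] (ψ : AddChar F ℂ)
    (v : (ι → F) → ℂ) : errorOp ψ 0 v = v := by
  ext x; simp [errorOp_apply]

theorem errorOp_errorOp {F ι : Type*} [Field F] [Fintype ι] (ψ : AddChar F ℂ)
    (e e' : (ι → F) × (ι → F)) (v : (ι → F) → ℂ) :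
    errorOp ψ e (errorOp ψ e' v) = ψ (∑ i, e.2 i * e'.1 i) • errorOp ψ (e + e') v := by
  ext x
  simp only [errorOp_apply, Pi.smul_apply, smul_eq_mul, ← mul_assoc, ← AddChar.map_add_eq_mul,
    Prod.fst_add, Prod.snd_add, sub_sub]
  rw [← Finset.sum_add_distrib, ← Finset.sum_add_distrib]
  congr 2
  refine Finset.sum_congr rfl fun i _ => ?_
  simp only [Pi.add_apply, Pi.sub_apply]
  ring

theorem errorOp_comm {F ι : Type*} [Field F] [Fintype ι] (ψ : AddChar F ℂ)
    (e e' : (ι → F) × (ι → F)) (v : (ι → F) → ℂ) :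
    errorOp ψ e (errorOp ψ e' v) = ψ (errorForm e e') • errorOp ψ e' (errorOp ψ e v) := by
  rw [errorOp_errorOp, errorOp_errorOp, smul_smul, ← AddChar.map_add_eq_mul, errorForm,
    sub_add_cancel, add_comm e']

/-- Error operators are unitary. -/
theorem star_errorOp_dotProduct {F ι : Type*} [Field F] [Fintype F] [Fintype ι] [DecidableEq ι]
    (ψ : AddChar F ℂ) (e : (ι → F) × (ι → F)) (u v : (ι → F) → ℂ) :
    star (errorOp ψ e u) ⬝ᵥ errorOp ψ e v = star u ⬝ᵥ v := by
  rw [dotProduct, dotProduct, ← Equiv.sum_comp (Equiv.subRight e.1) fun x => star u x * v x]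
  refine Finset.sum_congr rfl fun x _ => ?_
  simp only [Pi.star_apply, errorOp_apply, Equiv.subRight_apply, star_mul]
  have h : ∀ y : F, star (ψ y) * ψ y = 1 := fun y => by
    rw [Complex.star_def, ← Complex.normSq_eq_conj_mul_self, Complex.normSq_eq_norm_sq,
      ψ.norm_apply]
    simp
  linear_combination star (u (x - e.1)) * v (x - e.1) * h (∑ i, e.2 i * (x i - e.1 i))

open scoped ComplexOrder in
theorem star_mul_self_of_errorOp_eq_smul {F ι : Type*} [Field F] [Fintype F] [Fintype ι]
    [DecidableEq ι] {ψ : AddChar F ℂ} {e : (ι → F) × (ι → F)} {v : (ι → F) → ℂ} {c : ℂ}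
    (hv : v ≠ 0) (h : errorOp ψ e v = c • v) : star c * c = 1 := by
  have h1 := star_errorOp_dotProduct ψ e v v
  rw [h, star_smul, smul_dotProduct, dotProduct_smul, smul_smul, smul_eq_mul] at h1
  exact mul_right_cancel₀ (mt dotProduct_star_self_eq_zero.1 hv) (h1.trans (one_mul _).symm)

/-- Commuting operators on a nonzero finite-dimensional complex space have a common eigenvector. -/
theorem exists_joint_eigenvector {α V : Type*} [AddCommGroup V] [Module ℂ V]
    [FiniteDimensional ℂ V] [Nontrivial V] (f : α → V →ₗ[ℂ] V) (s : Finset α)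
    (hf : ∀ a ∈ s, ∀ b ∈ s, ∀ v, f a (f b v) = f b (f a v)) :
    ∃ (χ : α → ℂ) (v : V), v ≠ 0 ∧ ∀ a ∈ s, f a v = χ a • v := by
  classical
  induction s using Finset.induction_on with
  | empty =>
    obtain ⟨v, hv⟩ := exists_ne (0 : V)
    exact ⟨0, v, hv, by simp⟩
  | insert a s ha ih =>
    obtain ⟨χ, v, hv, hχ⟩ := ih fun b hb c hc =>
      hf b (Finset.mem_insert_of_mem hb) c (Finset.mem_insert_of_mem hc)
    let W : Submodule ℂ V := ⨅ b ∈ s, Module.End.eigenspace (f b) (χ b)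
    have hW : ∀ w, w ∈ W ↔ ∀ b ∈ s, f b w = χ b • w := by
      simp [W, Submodule.mem_iInf]
    have : Nontrivial W := ⟨⟨⟨v, (hW v).2 hχ⟩, 0, fun h => hv (congrArg Subtype.val h)⟩⟩
    have hmaps : ∀ w ∈ W, f a w ∈ W := fun w hw => (hW _).2 fun b hb => by
      rw [hf b (Finset.mem_insert_of_mem hb) a (Finset.mem_insert_self a s), (hW w).1 hw b hb,
        map_smul]
    obtain ⟨μ, hμ⟩ := Module.End.exists_eigenvalue ((f a).restrict hmaps)
    obtain ⟨w, hw⟩ := hμ.exists_hasEigenvector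
    refine ⟨Function.update χ a μ, w, fun h => hw.2 (Subtype.ext h), fun b hb => ?_⟩
    rcases Finset.mem_insert.1 hb with rfl | hbs
    · simpa using congrArg Subtype.val hw.apply_eq_smul
    · rw [Function.update_of_ne (by rintro rfl; exact ha hbs)]
      exact (hW w).1 w.2 b hbs

theorem exists_isStabilizerCode {F ι : Type*} [Field F] [Fintype F] [Fintype ι] [DecidableEq ι]
    (ψ : AddChar F ℂ) {S : Set ((ι → F) × (ι → F))}
    (hS : ∀ e ∈ S, ∀ e' ∈ S, errorForm e e' = 0) : ∃ Q, IsStabilizerCode ψ S Q := by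
  classical
  obtain ⟨χ, v, hv, hχ⟩ := exists_joint_eigenvector (errorOp ψ) S.toFinite.toFinset
    fun e he e' he' w => by
      rw [errorOp_comm, hS e (by simpa using he) e' (by simpa using he')]
      simp
  have hQ : ∀ w, w ∈ (⨅ e ∈ S, Module.End.eigenspace (errorOp ψ e) (χ e) : Submodule ℂ _) ↔
      ∀ e ∈ S, errorOp ψ e w = χ e • w := by
    simp [Submodule.mem_iInf]
  refine ⟨_, (Submodule.ne_bot_iff _).2 ⟨v, (hQ v).2 fun e he => hχ e (by simpa using he), hv⟩,
    χ, hQ⟩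

theorem trace_errorOp {F ι : Type*} [Field F] [Fintype F] [Fintype ι] [DecidableEq ι]
    {ψ : AddChar F ℂ} (hψ : ψ ≠ 1) {e : (ι → F) × (ι → F)} (he : e ≠ 0) :
    LinearMap.trace ℂ _ (errorOp ψ e) = 0 := by
  classical
  rw [LinearMap.trace_eq_matrix_trace ℂ (Pi.basisFun ℂ (ι → F))]
  simp only [Matrix.trace, Matrix.diag, LinearMap.toMatrix_apply, Pi.basisFun_apply,
    Pi.basisFun_repr, errorOp_apply]
  by_cases ha : e.1 = 0
  · have hb : e.2 ≠ 0 := fun hb => he (Prod.ext ha hb)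
    obtain ⟨i, hi⟩ := Function.ne_iff.1 hb
    obtain ⟨t, ht⟩ := AddChar.ne_one_iff.1 hψ
    let φ : AddChar (ι → F) ℂ := ψ.compAddMonoidHom
      { toFun := fun x => ∑ i, e.2 i * x i
        map_zero' := by simp
        map_add' := by intro x y; simp [mul_add, Finset.sum_add_distrib] }
    have hφ : φ ≠ 0 := by
      refine AddChar.ne_one_iff.2 ⟨Pi.single i (t / e.2 i), ?_⟩
      have hi' : e.2 i ≠ 0 := hi
      have : ∑ j, e.2 j * (Pi.single i (t / e.2 i) : ι → F) j = t := by
        rw [Finset.sum_eq_single i]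
        · simp [mul_div_cancel₀, hi']
        · intro j _ hj; simp [hj]
        · simp
      simpa [φ, this] using ht
    rw [← AddChar.sum_eq_zero_iff_ne_zero.2 hφ]
    refine Finset.sum_congr rfl fun x _ => ?_
    simp [ha, φ]
  · refine Finset.sum_eq_zero fun x _ => ?_
    rw [Pi.single_eq_of_ne, mul_zero]
    simpa using ha

/-- The dimension of a stabilizer code is the trace of the projection
`|S|⁻¹ ∑_{e ∈ S} χ(e)⁻¹ E_e` onto it, to which only the identity operator contributes. -/
theorem IsStabilizerCode.finrank_mul_card {F ι : Type*} [Field F] [Fintype F] [Fintype ι]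
    [DecidableEq ι] {ψ : AddChar F ℂ} (hψ : ψ ≠ 1) {S : AddSubgroup ((ι → F) × (ι → F))}
    {Q : Submodule ℂ ((ι → F) → ℂ)} (hQ : IsStabilizerCode ψ S Q) :
    Module.finrank ℂ Q * Nat.card S = Fintype.card F ^ Fintype.card ι := by
  classical
  obtain ⟨hne, χ, hχ⟩ := hQ
  obtain ⟨w, hw, hw0⟩ := (Submodule.ne_bot_iff _).1 hne
  have : Fintype S := Fintype.ofFinite S
  have hχ0 : ∀ e ∈ S, χ e ≠ 0 := fun e he h0 => by
    have := star_mul_self_of_errorOp_eq_smul hw0 ((hχ w).1 hw e he)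
    simp [h0] at this
  have hadd : ∀ e ∈ S, ∀ e' ∈ S, χ e * χ e' = ψ (∑ i, e.2 i * e'.1 i) * χ (e + e') := by
    intro e he e' he'
    have h := errorOp_errorOp ψ e e' w
    rw [(hχ w).1 hw e' he', map_smul, (hχ w).1 hw e he, (hχ w).1 hw _ (S.add_mem he he'),
      smul_smul, smul_smul] at h
    rw [mul_comm]
    exact smul_left_injective ℂ hw0 h
  have hcard : (Fintype.card S : ℂ) ≠ 0 := Nat.cast_ne_zero.2 Fintype.card_ne_zero
  let P : ((ι → F) → ℂ) →ₗ[ℂ] ((ι → F) → ℂ) :=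
    (Fintype.card S : ℂ)⁻¹ • ∑ e : S, (χ e)⁻¹ • errorOp ψ e
  have hPapply : ∀ v, P v = (Fintype.card S : ℂ)⁻¹ • ∑ e : S, (χ e)⁻¹ • errorOp ψ e v := by
    intro v; simp [P, LinearMap.sum_apply]
  have hP : LinearMap.IsProj Q P := by
    refine ⟨fun v => (hχ _).2 fun e' he' => ?_, fun v hv => ?_⟩
    · rw [hPapply, map_smul, map_sum, smul_comm (χ e')]
      congr 1
      rw [Finset.smul_sum, ← Equiv.sum_comp (Equiv.addLeft (⟨e', he'⟩ : S)) fun e : S =>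
        χ e' • (χ e)⁻¹ • errorOp ψ e v]
      refine Finset.sum_congr rfl fun e _ => ?_
      rw [map_smul, errorOp_errorOp, smul_smul, smul_smul]
      simp only [Equiv.coe_addLeft, AddSubgroup.coe_add]
      congr 1
      have h1 := hadd e' he' e e.2
      have h2 := hχ0 e e.2
      have h3 := hχ0 (e' + e) (S.add_mem he' e.2)
      field_simp
      linear_combination -h1
    · rw [hPapply, Finset.sum_congr rfl (g := fun _ => v)]
      · rw [Finset.sum_const, Finset.card_univ, ← Nat.cast_smul_eq_nsmul ℂ, smul_smul,
          inv_mul_cancel₀ hcard, one_smul]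
      · intro e _
        rw [(hχ v).1 hv e e.2, smul_smul, inv_mul_cancel₀ (hχ0 e e.2), one_smul]
  have htr : LinearMap.trace ℂ _ P =
      (Fintype.card S : ℂ)⁻¹ * (Fintype.card F ^ Fintype.card ι : ℕ) := by
    simp only [P, map_smul, map_sum, smul_eq_mul]
    rw [Finset.sum_eq_single (0 : S)]
    · have h0 : χ 0 = 1 := by
        have := hadd 0 S.zero_mem 0 S.zero_mem
        simp only [Prod.snd_zero, Pi.zero_apply, zero_mul, Finset.sum_const_zero,
          AddChar.map_zero_eq_one, add_zero, one_mul] at this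
        exact mul_left_cancel₀ (hχ0 0 S.zero_mem) (this.trans (mul_one _).symm)
      have h1 : errorOp ψ (0 : (ι → F) × (ι → F)) = LinearMap.id :=
        LinearMap.ext (errorOp_zero ψ)
      rw [AddSubgroup.coe_zero, h0, h1, LinearMap.trace_id, Module.finrank_pi]
      simp
    · intro e _ he
      rw [trace_errorOp hψ (fun h => he (Subtype.ext h)), mul_zero]
    · simp
  rw [hP.trace] at htr
  rw [Nat.card_eq_fintype_card]
  have : (Module.finrank ℂ Q : ℂ) * Fintype.card S = (Fintype.card F ^ Fintype.card ι : ℕ) := by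
    rw [htr]; field_simp
  exact_mod_cast this

/-- A stabilizer code detects every error `e` that fails to commute with some element of the
stabilizer: `⟨u, E_e v⟩` is then equal to a nontrivial multiple of itself. -/
theorem IsStabilizerCode.isQuantumCode {F ι : Type*} [Field F] [Fintype F] [Fintype ι]
    [DecidableEq ι] {ψ : AddChar F ℂ} (hψ : ψ ≠ 1) {S : AddSubgroup ((ι → F) × (ι → F))}
    {Q : Submodule ℂ ((ι → F) → ℂ)} (hQ : IsStabilizerCode ψ S Q) {k d : ℕ}
    (hcard : Fintype.card F ^ k * Nat.card S = Fintype.card F ^ Fintype.card ι)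
    (hd : ∀ e, errorWeight e < d → (∀ e' ∈ S, ψ (errorForm e' e) = 1) → e = 0) :
    IsQuantumCode ψ Q (Fintype.card ι) k d := by
  refine ⟨rfl, ?_, fun e he => ?_⟩
  · have h := hQ.finrank_mul_card hψ
    rw [← hcard] at h
    exact Nat.eq_of_mul_eq_mul_right Nat.card_pos h
  · by_cases h0 : e = 0
    · subst h0
      exact ⟨1, fun u _ v _ => by rw [errorOp_zero, one_mul]⟩
    · obtain ⟨e', he', hne⟩ : ∃ e' ∈ S, ψ (errorForm e' e) ≠ 1 := by
        by_contra! hall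
        exact h0 (hd e he hall)
      obtain ⟨hbot, χ, hχ⟩ := hQ
      obtain ⟨w, hw, hw0⟩ := (Submodule.ne_bot_iff _).1 hbot
      refine ⟨0, fun u hu v hv => ?_⟩
      have h1 := star_errorOp_dotProduct ψ e' u (errorOp ψ e v)
      rw [errorOp_comm, (hχ u).1 hu e' he', (hχ v).1 hv e' he', map_smul, star_smul,
        smul_dotProduct, dotProduct_smul, dotProduct_smul, smul_eq_mul, smul_eq_mul,
        smul_eq_mul] at h1
      have h2 := star_mul_self_of_errorOp_eq_smul hw0 ((hχ w).1 hw e' he')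
      have h3 : (ψ (errorForm e' e) - 1) * (star u ⬝ᵥ errorOp ψ e v) = 0 := by
        linear_combination h1 - ψ (errorForm e' e) * (star u ⬝ᵥ errorOp ψ e v) * h2
      rw [zero_mul]
      exact (mul_eq_zero.1 h3).resolve_left (sub_ne_zero.2 hne)

/-! ### Quantum codes induced by linear codes -/

theorem eq_zero_of_forall_addChar {F : Type*} [Field F] {ψ : AddChar F ℂ} (hψ : ψ ≠ 1) {a : F}
    (h : ∀ t, ψ (t * a) = 1) : a = 0 := by
  by_contra ha
  obtain ⟨t, ht⟩ := AddChar.ne_one_iff.1 hψ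
  exact ht (by simpa [ha] using h (t / a))

theorem errorForm_smul_left {F ι : Type*} [Field F] [Fintype ι] (t : F)
    (e e' : (ι → F) × (ι → F)) : errorForm (t • e) e' = t * errorForm e e' := by
  simp only [errorForm, Prod.smul_fst, Prod.smul_snd, Pi.smul_apply, smul_eq_mul, mul_sub,
    Finset.mul_sum]
  congr 1 <;> exact Finset.sum_congr rfl fun _ _ => by ring

/-- A word of a code supported on the support of an error of weight below the distance is zero. -/
theorem eq_zero_of_errorWeight_lt {F L ι : Type*} [Field F] [Field L] [Fintype ι]
    {C : Submodule L (ι → L)} {d : ℕ} (hd : minDist C = d) {e : (ι → F) × (ι → F)}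
    (he : errorWeight e < d) {x : ι → L} (hx : x ∈ C)
    (hsupp : ∀ i, x i ≠ 0 → e.1 i ≠ 0 ∨ e.2 i ≠ 0) : x = 0 := by
  classical
  by_contra h0
  have h1 := minDist_le hx h0
  rw [hd, Nat.cast_le] at h1
  have h2 : hammingNorm x ≤ errorWeight e :=
    Finset.card_le_card fun i hi => by
      simp only [Finset.mem_filter, Finset.mem_univ, true_and] at hi ⊢
      exact hsupp i hi
  omega

/-- The CSS construction. An error commuting with the stabilizer has both its parts in the bidual,
which is the code itself. -/
theorem inducedEuclidean {F ι : Type*} [Field F] [Fintype F] [Fintype ι] [DecidableEq ι]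
    {ψ : AddChar F ℂ} (hψ : ψ ≠ 1) {C : Submodule F (ι → F)} (hC : euclideanDual C ≤ C) {k d : ℕ}
    (hk : 2 * Module.finrank F C = Fintype.card ι + k) (hd : minDist C = d) :
    (∃ Q, IsInducedEuclidean ψ C Q) ∧
      ∀ Q, IsInducedEuclidean ψ C Q → IsQuantumCode ψ Q (Fintype.card ι) k d := by
  let S : AddSubgroup ((ι → F) × (ι → F)) :=
    (euclideanDual C).toAddSubgroup.prod (euclideanDual C).toAddSubgroup
  have hS : {e : (ι → F) × (ι → F) | e.1 ∈ euclideanDual C ∧ e.2 ∈ euclideanDual C} = S := rfl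
  simp only [IsInducedEuclidean, hS]
  refine ⟨exists_isStabilizerCode ψ fun e he e' he' => ?_, fun Q hQ =>
    hQ.isQuantumCode hψ ?_ fun e hwt he => ?_⟩
  · rw [errorForm, he.2 _ (hC he'.1), he'.2 _ (hC he.1), sub_zero]
  · have hcard : Nat.card S = Nat.card (euclideanDual C) * Nat.card (euclideanDual C) := by
      rw [← Nat.card_prod]
      exact Nat.card_congr (AddSubgroup.prodEquiv _ _).toEquiv
    have h1 := finrank_euclideanDual C
    rw [hcard, Module.natCard_eq_pow_finrank (K := F) (V := euclideanDual C),
      Nat.card_eq_fintype_card, ← pow_add, ← pow_add]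
    congr 1
    omega
  · have hbidual : euclideanDual (euclideanDual C) = C :=
      sesqDual_sesqDual (σ := RingHom.id F) (fun _ => rfl) C
    have h1 : e.1 = 0 := by
      refine eq_zero_of_errorWeight_lt hd hwt (hbidual ▸ fun y hy => ?_) fun i hi => Or.inl hi
      refine eq_zero_of_forall_addChar hψ fun t => ?_
      rw [← he (t • (0, y)) (((euclideanDual C).prod (euclideanDual C)).smul_mem t
        ⟨Submodule.zero_mem _, hy⟩), errorForm_smul_left]
      simp [errorForm, mul_comm]
    have h2 : e.2 = 0 := by
      refine eq_zero_of_errorWeight_lt hd hwt (hbidual ▸ fun y hy => ?_) fun i hi => Or.inr hi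
      refine eq_zero_of_forall_addChar hψ fun t => ?_
      rw [← he (-t • (y, 0)) (((euclideanDual C).prod (euclideanDual C)).smul_mem (-t)
        ⟨hy, Submodule.zero_mem _⟩), errorForm_smul_left]
      simp [errorForm]
    exact Prod.ext h1 h2

theorem frobenius_frobenius {F K : Type*} [Field F] [Fintype F] [Field K] [Algebra F K]
    (h : Module.finrank F K = 2) (x : K) :
    FiniteField.frobeniusAlgHom F K (FiniteField.frobeniusAlgHom F K x) = x := by
  have : FiniteDimensional F K := Module.finite_of_finrank_pos (by omega)
  have : Finite K := Module.finite_of_finite F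
  have : Fintype K := Fintype.ofFinite K
  have hcard : Fintype.card K = Fintype.card F ^ 2 := by
    rw [← Nat.card_eq_fintype_card, ← Nat.card_eq_fintype_card,
      Module.natCard_eq_pow_finrank (K := F) (V := K), h]
  simp only [FiniteField.coe_frobeniusAlgHom]
  rw [← pow_mul, ← sq, ← hcard, FiniteField.pow_card]

/-- If `γ / β` were fixed by the Frobenius map, then it would lie in the small field. -/
theorem basis_mul_frobenius_ne {F K : Type*} [Field F] [Fintype F] [Field K] [Algebra F K]
    (β : Module.Basis (Fin 2) F K) :
    β 1 * FiniteField.frobeniusAlgHom F K (β 0) -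
      β 0 * FiniteField.frobeniusAlgHom F K (β 1) ≠ 0 := by
  intro h
  have : FiniteDimensional F K := Module.Basis.finiteDimensional_of_finite β
  have : Finite K := Module.finite_of_finite F
  have h0 : β 0 ≠ 0 := β.ne_zero 0
  have hfix : FiniteField.frobeniusAlgHom F K (β 1 / β 0) = β 1 / β 0 := by
    have h0' : FiniteField.frobeniusAlgHom F K (β 0) ≠ 0 := (map_ne_zero _).2 h0
    rw [map_div₀, div_eq_div_iff h0' h0]
    linear_combination -h
  obtain ⟨c, hc⟩ : β 1 / β 0 ∈ Set.range (algebraMap F K) := by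
    rw [IsGalois.mem_range_algebraMap_iff_fixed]
    intro g
    obtain ⟨m, rfl⟩ := (FiniteField.bijective_frobeniusAlgEquivOfAlgebraic_pow F K).2 g
    rw [AlgEquiv.coe_pow]
    exact Function.iterate_fixed hfix _
  have hlin : β 1 = c • β 0 := by
    rw [Algebra.smul_def, hc, div_mul_cancel₀ _ h0]
  have hrepr := congrArg (fun x => β.repr x 1) hlin
  simp at hrepr

/-- An error `(a, b)` over the small field, encoded as the word `β a + γ b` over the large one. -/
noncomputable def errorEquiv {F K : Type*} (ι : Type*) [Field F] [Field K] [Algebra F K]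
    (β : Module.Basis (Fin 2) F K) : ((ι → F) × (ι → F)) ≃ₗ[F] (ι → K) where
  toFun e := fun i => e.1 i • β 0 + e.2 i • β 1
  invFun w := (fun i => β.repr (w i) 0, fun i => β.repr (w i) 1)
  map_add' e e' := by ext i; simp only [Prod.fst_add, Prod.snd_add, Pi.add_apply, add_smul]; abel
  map_smul' t e := by ext i; simp [mul_smul]
  left_inv e := by ext i <;> simp
  right_inv w := by
    ext i
    exact (Fin.sum_univ_two _).symm.trans (β.sum_repr (w i))

/-- The symplectic form on errors is, up to a nonzero constant, the antisymmetric part of the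
Hermitian form. -/
theorem sesqForm_sub_sesqForm {F K ι : Type*} [Field F] [Fintype F] [Field K] [Algebra F K]
    [Fintype ι] (β : Module.Basis (Fin 2) F K) (e e' : (ι → F) × (ι → F)) :
    ∑ i, errorEquiv ι β e i * FiniteField.frobeniusAlgHom F K (errorEquiv ι β e' i) -
        ∑ i, errorEquiv ι β e' i * FiniteField.frobeniusAlgHom F K (errorEquiv ι β e i) =
      (β 1 * FiniteField.frobeniusAlgHom F K (β 0) -
        β 0 * FiniteField.frobeniusAlgHom F K (β 1)) * algebraMap F K (errorForm e e') := by
  simp only [errorForm, map_sub, map_sum, ← Finset.sum_sub_distrib, Finset.mul_sum]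
  refine Finset.sum_congr rfl fun i _ => ?_
  simp only [errorEquiv, LinearEquiv.coe_mk, LinearMap.coe_mk, AddHom.coe_mk, map_add, map_mul,
    Algebra.smul_def]
  simp only [AlgHom.commutes]
  ring

/-- An error commuting with the stabilizer gives a word `w` with `⟨w', w⟩` fixed by the Frobenius
map for all `w'` in the dual. The dual being a subspace over the large field, these values form a
subspace too and so vanish: `w` lies in the bidual, which is the code itself. -/
theorem inducedHermitian {F K ι : Type*} [Field F] [Fintype F] [Field K] [Algebra F K]
    [Fintype ι] [DecidableEq ι] (hK : Module.finrank F K = 2) {ψ : AddChar F ℂ} (hψ : ψ ≠ 1)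
    {C : Submodule K (ι → K)} (hC : hermitianDual (Fintype.card F) C ≤ C) {k d : ℕ}
    (hk : 2 * Module.finrank K C = Fintype.card ι + k) (hd : minDist C = d) :
    (∃ Q, IsInducedHermitian ψ C Q) ∧
      ∀ Q, IsInducedHermitian ψ C Q → IsQuantumCode ψ Q (Fintype.card ι) k d := by
  have : FiniteDimensional F K := Module.finite_of_finrank_pos (by omega)
  have : Finite K := Module.finite_of_finite F
  set σ : K →+* K := (FiniteField.frobeniusAlgHom F K : K →+* K) with hσdef
  have hσ : ∀ x, σ (σ x) = x := frobenius_frobenius hK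
  have hdual : hermitianDual (Fintype.card F) C = sesqDual σ C := rfl
  rw [hdual] at hC
  let S (β : Module.Basis (Fin 2) F K) : AddSubgroup ((ι → F) × (ι → F)) :=
    (sesqDual σ C).toAddSubgroup.comap (errorEquiv ι β).toAddEquiv.toAddMonoidHom
  have hS : ∀ β : Module.Basis (Fin 2) F K, {e : (ι → F) × (ι → F) |
      (fun i => e.1 i • β 0 + e.2 i • β 1) ∈ hermitianDual (Fintype.card F) C} = S β :=
    fun _ => rfl
  have hmem : ∀ β e, e ∈ S β ↔ errorEquiv ι β e ∈ sesqDual σ C := fun _ _ => Iff.rfl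
  simp only [IsInducedHermitian, hS]
  constructor
  · let β : Module.Basis (Fin 2) F K := Module.finBasisOfFinrankEq F K hK
    obtain ⟨Q, hQ⟩ := exists_isStabilizerCode ψ (S := (S β : Set ((ι → F) × (ι → F))))
      fun e he e' he' => by
        have h := sesqForm_sub_sesqForm β e e'
        have h1 : ∑ i, errorEquiv ι β e i * σ (errorEquiv ι β e' i) = 0 :=
          (hmem β e).1 he _ (hC he')
        have h2 : ∑ i, errorEquiv ι β e' i * σ (errorEquiv ι β e i) = 0 :=
          (hmem β e').1 he' _ (hC he)
        change ∑ i, errorEquiv ι β e i * σ (errorEquiv ι β e' i) -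
          ∑ i, errorEquiv ι β e' i * σ (errorEquiv ι β e i) = _ at h
        rw [h1, h2, sub_zero] at h
        exact (map_eq_zero _).1 ((mul_eq_zero.1 h.symm).resolve_left (basis_mul_frobenius_ne β))
    exact ⟨Q, β, hQ⟩
  · rintro Q ⟨β, hQ⟩
    refine hQ.isQuantumCode hψ ?_ fun e hwt he => ?_
    · have hcard : Nat.card (S β) = Nat.card (sesqDual σ C) :=
        Nat.card_congr ((errorEquiv ι β).toEquiv.subtypeEquiv fun e => hmem β e)
      have h1 := finrank_sesqDual hσ C
      rw [hcard, Module.natCard_eq_pow_finrank (K := K) (V := sesqDual σ C),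
        Module.natCard_eq_pow_finrank (K := F) (V := K), hK, Nat.card_eq_fintype_card, ← pow_mul,
        ← pow_add]
      congr 1
      omega
    · have hform : ∀ e' ∈ S β, errorForm e' e = 0 := fun e' he' =>
        eq_zero_of_forall_addChar hψ fun t => by
          rw [← errorForm_smul_left]
          refine he _ ((hmem _ _).2 ?_)
          rw [map_smul, ← algebraMap_smul K t]
          exact Submodule.smul_mem _ _ he'
      have hfix : ∀ y ∈ sesqDual σ C, σ (∑ i, y i * σ (errorEquiv ι β e i)) =
          ∑ i, y i * σ (errorEquiv ι β e i) := by
        intro y hy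
        obtain ⟨e', rfl⟩ := (errorEquiv ι β).surjective y
        have h := sesqForm_sub_sesqForm β e' e
        rw [hform e' hy, map_zero (algebraMap F K), mul_zero, sub_eq_zero] at h
        rw [sum_mul_map_comm hσ]
        exact h.symm
      have hw : errorEquiv ι β e ∈ C := by
        rw [← sesqDual_sesqDual hσ C]
        intro y hy
        rw [← sum_mul_map_comm hσ, map_eq_zero_iff σ σ.injective]
        by_contra hne
        have hid : ∀ z, σ z = z := by
          intro z
          have h := hfix ((z / ∑ i, y i * σ (errorEquiv ι β e i)) • y) (Submodule.smul_mem _ _ hy)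
          simp only [Pi.smul_apply, smul_eq_mul, mul_assoc, ← Finset.mul_sum] at h
          rwa [div_mul_cancel₀ _ hne] at h
        refine basis_mul_frobenius_ne β ?_
        change β 1 * σ (β 0) - β 0 * σ (β 1) = 0
        rw [hid, hid]
        ring
      have hw0 := eq_zero_of_errorWeight_lt hd hwt hw fun i hi => by
        by_contra! h
        exact hi (by simp [errorEquiv, h.1, h.2])
      exact (errorEquiv ι β).map_eq_zero_iff.1 hw0

/-! ### Optimality of matrix-product codes -/

/-- For fixed length, `r` and `δ`, the dimension of an optimal locally repairable code decreases
with its distance; in particular it is determined by the distance. -/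
theorem IsOptimalLRC.dim_le_of_dist_le {L ι : Type*} [Field L] [Fintype ι] {r δ n k d k' d' : ℕ}
    {C C' : Submodule L (ι → L)} (hδ : 2 ≤ δ) (h : IsOptimalLRC C r δ n k d)
    (h' : IsOptimalLRC C' r δ n k' d') (hd : d' ≤ d) : k ≤ k' := by
  by_contra! hlt
  have h1 := h.optimal
  have h2 := h'.optimal
  have hceil : ⌈(k' : ℚ) / r⌉ ≤ ⌈(k : ℚ) / r⌉ := by gcongr
  have hmul := mul_le_mul_of_nonneg_right hceil (show (0 : ℤ) ≤ (δ : ℤ) - 1 by omega)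
  have : (k' : ℤ) < k := by exact_mod_cast hlt
  have : (d' : ℤ) ≤ d := by exact_mod_cast hd
  linarith

theorem IsOptimalLRC.le_dist {L ι : Type*} [Field L] [Fintype ι] {r δ n k d : ℕ}
    {C : Submodule L (ι → L)} (h : IsOptimalLRC C r δ n k d) : δ ≤ d := by
  have := h.lrc.le_minDist
  rw [h.dist] at this
  exact_mod_cast this

theorem ceil_sum_le {α : Type*} (s : Finset α) (f : α → ℚ) : ⌈∑ i ∈ s, f i⌉ ≤ ∑ i ∈ s, ⌈f i⌉ := by
  rw [Int.ceil_le]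
  push_cast
  exact Finset.sum_le_sum fun i _ => Int.le_ceil _

theorem eq_last_of_not_lt {N : ℕ} (hN : 2 ≤ N) {i : Fin N} (h : ¬ (i : ℕ) < N - 1) :
    i = ⟨N - 1, by omega⟩ :=
  Fin.ext (by have := i.2; simp only; omega)

theorem sum_eq_of_eq_const {R : Type*} [CommRing R] {N : ℕ} (hN : 2 ≤ N) (f : Fin N → R) {a : R}
    (h : ∀ i : Fin N, (i : ℕ) < N - 1 → f i = a) :
    ∑ i, f i = ((N : R) - 1) * a + f ⟨N - 1, by omega⟩ := by
  obtain ⟨M, rfl⟩ : ∃ M, N = M + 1 := ⟨N - 1, by omega⟩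
  rw [Fin.sum_univ_castSucc, Finset.sum_congr rfl fun i _ => h i.castSucc (by simp)]
  simp [Fin.last]

/-- The defect from optimality of the matrix-product code is
`∑ (d_i - δ) + δ - d + (δ - 1) (∑ ⌈k_i / r⌉ - ⌈∑ k_i / r⌉)`. As `δ ≤ d_i` and `d ≤ d_N`, it is a
sum of the nonnegative terms `d_i - δ` for `i < N`, `d_N - d` and the ceiling term. -/
theorem optimal_iff_of_dist_le {N n r δ d' k' : ℕ} (hN : 2 ≤ N) (hδ : 2 ≤ δ)
    {k d : Fin N → ℕ} (hk : 2 * ∑ i, k i = N * n + k')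
    (hopt : ∀ i, (d i : ℤ) = n - k i + 1 - (⌈(k i : ℚ) / r⌉ - 1) * ((δ : ℤ) - 1))
    (hd : ∀ i, δ ≤ d i) (hd' : d' ≤ d ⟨N - 1, by omega⟩) :
    (k' : ℤ) + 2 * d' + 2 * (⌈(((N * n : ℕ) : ℚ) + k') / (2 * r)⌉ - 1) * ((δ : ℤ) - 1) =
        (N * n : ℕ) + 2 ↔
      (∀ i : Fin N, (i : ℕ) < N - 1 → d i = δ) ∧ d' = d ⟨N - 1, by omega⟩ ∧
        ⌈∑ i, (k i : ℚ) / r⌉ = ∑ i, ⌈(k i : ℚ) / r⌉ := by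
  set l : Fin N := ⟨N - 1, by omega⟩
  have hceil : (((N * n : ℕ) : ℚ) + k') / (2 * r) = ∑ i, (k i : ℚ) / r := by
    rw [← Finset.sum_div, ← Nat.cast_add, ← hk]
    push_cast
    rw [mul_div_mul_left _ _ two_ne_zero]
  have hsum : ∑ i, ((d i : ℤ) - δ) = N * n - (∑ i, k i : ℕ) + N -
      (∑ i, ⌈(k i : ℚ) / r⌉) * ((δ : ℤ) - 1) + N * ((δ : ℤ) - 1) - N * δ := by
    rw [Finset.sum_congr rfl fun i _ => by rw [hopt i]]
    simp only [Finset.sum_sub_distrib, Finset.sum_add_distrib, ← Finset.sum_mul, Finset.sum_const,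
      Finset.card_univ, Fintype.card_fin, nsmul_eq_mul, Nat.cast_sum]
    ring
  have hle := ceil_sum_le Finset.univ fun i => (k i : ℚ) / r
  rw [← Finset.add_sum_erase _ _ (Finset.mem_univ l)] at hsum
  have hnonneg : ∀ i ∈ Finset.univ.erase l, (0 : ℤ) ≤ (d i : ℤ) - δ := fun i _ =>
    sub_nonneg.2 (by exact_mod_cast hd i)
  have hk2 : 2 * ((∑ i, k i : ℕ) : ℤ) = N * n + k' := by exact_mod_cast hk
  have hd2 : (d' : ℤ) ≤ d l := by exact_mod_cast hd'
  have hδ2 : (2 : ℤ) ≤ δ := by exact_mod_cast hδ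
  have hzero : (∑ i ∈ Finset.univ.erase l, ((d i : ℤ) - δ) = 0) ↔
      ∀ i : Fin N, (i : ℕ) < N - 1 → d i = δ := by
    rw [Finset.sum_eq_zero_iff_of_nonneg hnonneg]
    refine forall_congr' fun i => ?_
    have h1 : i ∈ Finset.univ.erase l ↔ (i : ℕ) < N - 1 := by
      have := i.2
      simp only [Finset.mem_erase, Finset.mem_univ, and_true, ne_eq, Fin.ext_iff, l]
      omega
    rw [h1, sub_eq_zero, Nat.cast_inj]
  have hpos := Finset.sum_nonneg hnonneg
  rw [← hzero, hceil]
  set T := ∑ i ∈ Finset.univ.erase l, ((d i : ℤ) - δ)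
  set X := ⌈∑ i, (k i : ℚ) / r⌉
  set Y := ∑ i, ⌈(k i : ℚ) / r⌉
  push_cast
  constructor
  · intro h
    have hdefect : T + ((d l : ℤ) - d') + (Y - X) * ((δ : ℤ) - 1) = 0 := by linarith
    have hmul : 0 ≤ (Y - X) * ((δ : ℤ) - 1) := mul_nonneg (by omega) (by omega)
    refine ⟨by linarith, by zify; linarith, ?_⟩
    have : (Y - X) * ((δ : ℤ) - 1) = 0 := by linarith
    rcases mul_eq_zero.1 this with h | h <;> omega
  · rintro ⟨h1, h2, h3⟩
    rw [h1] at hsum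
    rw [← h3, ← h2] at hsum
    linarith

/-- If the first `N - 1` codes have distance `δ`, then the distance `min_l d_l D_l(A)` of the
matrix-product code is `d_N` if and only if the term `l = N - 1` is not smaller. -/
theorem minDist_mpCode_eq_iff {L : Type*} [Field L] {N n δ : ℕ} (hN : 2 ≤ N)
    {C : Fin N → Submodule L (Fin n → L)} {A : Matrix (Fin N) (Fin N) L} {d : Fin N → ℕ}
    (hA : IsUnit A) (hC : Antitone C) (hd : ∀ i, minDist (C i) = d i)
    (h : ∀ i : Fin N, (i : ℕ) < N - 1 → d i = δ) :
    minDist (mpCode C A) = d ⟨N - 1, by omega⟩ ↔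
      (d ⟨N - 1, by omega⟩ : ℕ∞) ≤ δ * rowDist A (N - 1) := by
  have hN1 : N - 2 + 1 = N - 1 := by omega
  have hN2 : N - 1 + 1 = N := by omega
  constructor
  · intro heq
    have := minDist_mpCode_le (A := A) hC ⟨N - 2, by omega⟩
    rwa [heq, hd, h ⟨N - 2, by omega⟩ (show N - 2 < N - 1 by omega), Fin.val_mk, hN1] at this
  · intro hle
    refine le_antisymm ?_ (le_minDist_mpCode hA fun l => ?_)
    · have := minDist_mpCode_le (A := A) hC ⟨N - 1, by omega⟩
      rwa [hd, Fin.val_mk, hN2, rowDist_self (by omega) hA, mul_one] at this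
    · by_cases hl : (l : ℕ) < N - 1
      · rw [hd, h l hl]
        refine hle.trans ?_
        gcongr
        exact rowDist_anti A (by omega)
      · rw [eq_last_of_not_lt hN hl, hd, Fin.val_mk, hN2, rowDist_self (by omega) hA, mul_one]

theorem minDist_mpCode_le_last {L : Type*} [Field L] {N n : ℕ} (hN : 2 ≤ N)
    {C : Fin N → Submodule L (Fin n → L)} {A : Matrix (Fin N) (Fin N) L} (hA : IsUnit A)
    (hC : Antitone C) : minDist (mpCode C A) ≤ minDist (C ⟨N - 1, by omega⟩) := by
  have := minDist_mpCode_le (A := A) hC ⟨N - 1, by omega⟩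
  rwa [Fin.val_mk, Nat.sub_add_cancel (by omega), rowDist_self (by omega) hA, mul_one] at this

/-- The two cases are distinguished by the value of `D_{N-1}(A)`, which is `1` or `2`. -/
theorem caseI_or_caseII_iff {L : Type*} [Field L] {N n r δ : ℕ} (hN : 2 ≤ N) (hδ : 2 ≤ δ)
    {C : Fin N → Submodule L (Fin n → L)} {A : Matrix (Fin N) (Fin N) L} {k d : Fin N → ℕ}
    (hA : IsUnit A) (hC : Antitone C) (hopt : ∀ i, IsOptimalLRC (C i) r δ n (k i) (d i)) :
    CaseI hN C A r δ k d ∨ CaseII hN C A r δ k d ↔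
      (∀ i : Fin N, (i : ℕ) < N - 1 → d i = δ) ∧
        minDist (mpCode C A) = d ⟨N - 1, by omega⟩ ∧
        ⌈∑ i, (k i : ℚ) / r⌉ = ∑ i, ⌈(k i : ℚ) / r⌉ := by
  have hkeq : ∀ i j, C i = C j → k i = k j := fun i j h => by
    rw [← (hopt i).dim, ← (hopt j).dim, h]
  have hCeq : ∀ i j, d i = d j → C i = C j := by
    intro i j h
    have hk : k i = k j := le_antisymm ((hopt i).dim_le_of_dist_le hδ (hopt j) h.ge)
      ((hopt j).dim_le_of_dist_le hδ (hopt i) h.le)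
    have hrank : Module.finrank L (C i) = Module.finrank L (C j) := by
      rw [(hopt i).dim, (hopt j).dim, hk]
    rcases le_total i j with hij | hij
    · exact (Submodule.eq_of_le_of_finrank_eq (hC hij) hrank.symm).symm
    · exact Submodule.eq_of_le_of_finrank_eq (hC hij) hrank
  -- The form of the ceiling condition in the second case.
  have hceil : (∀ i : Fin N, (i : ℕ) < N - 1 → k i = k ⟨0, by omega⟩) →
      (⌈∑ i, (k i : ℚ) / r⌉ = ∑ i, ⌈(k i : ℚ) / r⌉ ↔
        ⌈(((N : ℚ) - 1) * k ⟨0, by omega⟩ + k ⟨N - 1, by omega⟩) / r⌉ =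
          ((N : ℤ) - 1) * ⌈(k ⟨0, by omega⟩ : ℚ) / r⌉ + ⌈(k ⟨N - 1, by omega⟩ : ℚ) / r⌉) := by
    intro hk
    rw [sum_eq_of_eq_const hN _ (a := (k ⟨0, by omega⟩ : ℚ) / r) fun i hi => by rw [hk i hi],
      sum_eq_of_eq_const hN _ (a := ⌈(k ⟨0, by omega⟩ : ℚ) / r⌉) fun i hi => by rw [hk i hi],
      add_div, mul_div_assoc]
  have hceilI : k ⟨N - 1, by omega⟩ = k ⟨0, by omega⟩ →
      (⌈(((N : ℚ) - 1) * k ⟨0, by omega⟩ + k ⟨N - 1, by omega⟩) / r⌉ =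
          ((N : ℤ) - 1) * ⌈(k ⟨0, by omega⟩ : ℚ) / r⌉ + ⌈(k ⟨N - 1, by omega⟩ : ℚ) / r⌉ ↔
        ⌈((N : ℚ) * k ⟨0, by omega⟩) / r⌉ = N * ⌈(k ⟨0, by omega⟩ : ℚ) / r⌉) := by
    intro hk
    rw [hk]
    ring_nf
  have h0 : (0 : ℕ) < N - 1 := by omega
  constructor
  · rintro (⟨hD, hCC, hd, hc⟩ | ⟨hD, hCC, hd, hdN, hc⟩)
    · have hk : ∀ i j, k i = k j := fun i j => hkeq i j (hCC i j)
      refine ⟨fun i _ => hd i, ?_, (hceil fun i _ => hk _ _).2 ((hceilI (hk _ _)).2 hc)⟩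
      rw [minDist_mpCode_eq_iff hN hA hC (fun i => (hopt i).dist) fun i _ => hd i, hD, hd, mul_one]
    · refine ⟨hd, ?_, (hceil fun i hi => hkeq _ _ (hCC _ _ hi h0)).2 hc⟩
      rw [minDist_mpCode_eq_iff hN hA hC (fun i => (hopt i).dist) hd, hD, mul_comm]
      exact_mod_cast hdN
  · rintro ⟨hd, hdist, hc⟩
    rw [minDist_mpCode_eq_iff hN hA hC (fun i => (hopt i).dist) hd] at hdist
    have hCC : ∀ i j : Fin N, (i : ℕ) < N - 1 → (j : ℕ) < N - 1 → C i = C j := fun i j hi hj =>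
      hCeq i j (by rw [hd i hi, hd j hj])
    have hc' := (hceil fun i hi => hkeq _ _ (hCC _ _ hi h0)).1 hc
    have h1 : 1 ≤ rowDist A (N - 1) := one_le_minDist _
    have h2 := rowDist_pred_le_two hN hA
    rcases h1.eq_or_lt with h1 | h1
    · left
      rw [← h1, mul_one, Nat.cast_le] at hdist
      have hd' : ∀ i, d i = δ := fun i => by
        by_cases hi : (i : ℕ) < N - 1
        · exact hd i hi
        · rw [eq_last_of_not_lt hN hi]
          exact le_antisymm hdist (hopt _).le_dist
      have hCC' : ∀ i j, C i = C j := fun i j => hCeq i j (by rw [hd' i, hd' j])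
      exact ⟨h1.symm, hCC', hd', (hceilI (hkeq _ _ (hCC' _ _))).1 hc'⟩
    · right
      have hD : rowDist A (N - 1) = 2 := le_antisymm h2 (by
        have := Order.add_one_le_of_lt h1
        rwa [one_add_one_eq_two] at this)
      rw [hD, mul_comm] at hdist
      exact ⟨hD, hCC, hd, by exact_mod_cast hdist, hc'⟩

/-- The characterization for an arbitrary notion of duality: it suffices that the code contains its
dual and that the induced quantum codes have the expected parameters. -/
theorem mpCode_inducesOptimalQLRC {F L : Type*} [Field F] [Fintype F] [Field L]
    {ψ : AddChar F ℂ} {N n r δ : ℕ} (hN : 2 ≤ N) (hδ : 2 ≤ δ)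
    {C : Fin N → Submodule L (Fin n → L)} {A : Matrix (Fin N) (Fin N) L} {k d : Fin N → ℕ}
    (hA : IsUnit A) (hC : Antitone C) (hopt : ∀ i, IsOptimalLRC (C i) r δ n (k i) (d i))
    {D : Submodule L (Fin N × Fin n → L)} {Ind : Submodule ℂ ((Fin N × Fin n → F) → ℂ) → Prop}
    (hD : D ≤ mpCode C A)
    (hrank : ∃ k', 2 * Module.finrank L (mpCode C A) = Fintype.card (Fin N × Fin n) + k')
    (hInd : ∀ {k' d' : ℕ}, 2 * Module.finrank L (mpCode C A) = Fintype.card (Fin N × Fin n) + k' →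
      minDist (mpCode C A) = d' →
      (∃ Q, Ind Q) ∧ ∀ Q, Ind Q → IsQuantumCode ψ Q (Fintype.card (Fin N × Fin n)) k' d') :
    ((∃ n' k' d', InducesOptimalQLRC ψ (mpCode C A) D Ind r δ n' k' d') ↔
        CaseI hN C A r δ k d ∨ CaseII hN C A r δ k d) ∧
      (CaseI hN C A r δ k d →
        ∃ k' : ℕ, (k' : ℤ) = 2 * N * k ⟨0, by omega⟩ - N * n ∧
          InducesOptimalQLRC ψ (mpCode C A) D Ind r δ (N * n) k' δ) ∧
      (CaseII hN C A r δ k d →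
        ∃ k' : ℕ, (k' : ℤ) =
            2 * ((N : ℤ) - 1) * k ⟨0, by omega⟩ + 2 * k ⟨N - 1, by omega⟩ - N * n ∧
          InducesOptimalQLRC ψ (mpCode C A) D Ind r δ (N * n) k' (d ⟨N - 1, by omega⟩)) := by
  have hN0 : 0 < N := by omega
  have hN1 : 0 < N - 1 := by omega
  have hcard : Fintype.card (Fin N × Fin n) = N * n := by simp
  simp only [hcard] at hrank hInd
  have hfin : Module.finrank L (mpCode C A) = ∑ i, k i := by
    rw [finrank_mpCode C hA]
    exact Finset.sum_congr rfl fun i _ => (hopt i).dim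
  have hcases := caseI_or_caseII_iff hN hδ hA hC hopt
  have hlast := minDist_mpCode_le_last hN (A := A) hA hC
  rw [(hopt _).dist] at hlast
  have hlrc : IsLRC (mpCode C A) r δ :=
    (hopt ⟨0, by omega⟩).lrc.mpCode fun l => hC (Fin.le_def.2 (Nat.zero_le _))
  have hiff : ∀ {k' d' : ℕ}, 2 * ∑ i, k i = N * n + k' → minDist (mpCode C A) = d' →
      ((k' : ℤ) + 2 * d' + 2 * (⌈(((N * n : ℕ) : ℚ) + k') / (2 * r)⌉ - 1) * ((δ : ℤ) - 1) =
        (N * n : ℕ) + 2 ↔ CaseI hN C A r δ k d ∨ CaseII hN C A r δ k d) := by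
    intro k' d' hk' hd'
    rw [hcases, hd', Nat.cast_inj]
    rw [hd', Nat.cast_le] at hlast
    exact optimal_iff_of_dist_le hN hδ hk' (fun i => (hopt i).optimal) (fun i => (hopt i).le_dist)
      hlast
  obtain ⟨k', hk'⟩ := hrank
  have main : CaseI hN C A r δ k d ∨ CaseII hN C A r δ k d →
      InducesOptimalQLRC ψ (mpCode C A) D Ind r δ (N * n) k' (d ⟨N - 1, by omega⟩) := by
    intro h
    have hd' := (hcases.1 h).2.1
    obtain ⟨hQ, hpar⟩ := hInd hk' hd'
    exact ⟨hcard, hD, hk', hlrc, hlrc.le_minDist.trans (minDist_anti hD), hd', hQ, hpar,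
      (hiff (hfin ▸ hk') hd').2 h⟩
  rw [hfin] at hk'
  have hk2 : (2 : ℤ) * ∑ i, (k i : ℤ) = N * n + k' := by exact_mod_cast hk'
  have hkeq : ∀ i j, C i = C j → (k i : ℤ) = k j := fun i j h => by
    rw [← (hopt i).dim, ← (hopt j).dim, h]
  refine ⟨⟨?_, fun h => ⟨_, _, _, main h⟩⟩, fun h => ⟨k', ?_, ?_⟩, fun h => ⟨k', ?_, main (.inr h)⟩⟩
  · rintro ⟨n', k'', d', h⟩
    obtain rfl : N * n = n' := hcard.symm.trans h.length
    exact (hiff (hfin ▸ h.dim) h.dist).1 h.optimal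
  · rw [Finset.sum_congr rfl fun i _ => hkeq i ⟨0, hN0⟩ (h.2.1 _ _)] at hk2
    simp only [Finset.sum_const, Finset.card_univ, Fintype.card_fin, nsmul_eq_mul] at hk2
    linarith
  · have := main (.inl h)
    rwa [h.2.2.1] at this
  · rw [sum_eq_of_eq_const hN _ fun i hi => hkeq i ⟨0, hN0⟩ (h.2.1 i _ hi hN1)] at hk2
    linarith

/-! ### The characterization for both dualities -/

theorem theorem3 {F : Type*} [Field F] [Fintype F] (ψ : AddChar F ℂ) (hψ : ψ ≠ 1)
    (r δ N n : ℕ) (hr : 1 ≤ r) (hδ : 2 ≤ δ) (hN : 2 ≤ N) (k d : Fin N → ℕ)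
    (τ : Equiv.Perm (Fin N)) :
    -- Hermitian version, over the field `K` with `q ^ 2` elements, `q = |F|`
    (∀ {K : Type*} [Field K] [Algebra F K], Module.finrank F K = 2 →
      ∀ (C : Fin N → Submodule K (Fin n → K)) (A : Matrix (Fin N) (Fin N) K),
      IsUnit A → (∀ i, IsOptimalLRC (C i) r δ n (k i) (d i)) → Antitone C →
      IsMinorPerm (A * conjTransposeQ (Fintype.card F) A) τ →
      (∀ i, hermitianDual (Fintype.card F) (C (τ i)) ≤ C i) →
      ((∃ n' k' d', InducesHermitian ψ (mpCode C A) r δ n' k' d') ↔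
        CaseI hN C A r δ k d ∨ CaseII hN C A r δ k d) ∧
      (CaseI hN C A r δ k d →
        ∃ k' : ℕ, (k' : ℤ) = 2 * N * k ⟨0, by omega⟩ - N * n ∧
          InducesHermitian ψ (mpCode C A) r δ (N * n) k' δ) ∧
      (CaseII hN C A r δ k d →
        ∃ k' : ℕ, (k' : ℤ) =
            2 * ((N : ℤ) - 1) * k ⟨0, by omega⟩ + 2 * k ⟨N - 1, by omega⟩ - N * n ∧
          InducesHermitian ψ (mpCode C A) r δ (N * n) k' (d ⟨N - 1, by omega⟩))) ∧
    -- Euclidean version, over `F`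
    (∀ (C : Fin N → Submodule F (Fin n → F)) (A : Matrix (Fin N) (Fin N) F),
      IsUnit A → (∀ i, IsOptimalLRC (C i) r δ n (k i) (d i)) → Antitone C →
      IsMinorPerm (A * A.transpose) τ →
      (∀ i, euclideanDual (C (τ i)) ≤ C i) →
      ((∃ n' k' d', InducesEuclidean ψ (mpCode C A) r δ n' k' d') ↔
        CaseI hN C A r δ k d ∨ CaseII hN C A r δ k d) ∧
      (CaseI hN C A r δ k d →
        ∃ k' : ℕ, (k' : ℤ) = 2 * N * k ⟨0, by omega⟩ - N * n ∧
          InducesEuclidean ψ (mpCode C A) r δ (N * n) k' δ) ∧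
      (CaseII hN C A r δ k d →
        ∃ k' : ℕ, (k' : ℤ) =
            2 * ((N : ℤ) - 1) * k ⟨0, by omega⟩ + 2 * k ⟨N - 1, by omega⟩ - N * n ∧
          InducesEuclidean ψ (mpCode C A) r δ (N * n) k' (d ⟨N - 1, by omega⟩))) := by
  constructor
  · intro K _ _ hK C A hA hopt hC hτ hdual
    have : FiniteDimensional F K := Module.finite_of_finrank_pos (by omega)
    have : Finite K := Module.finite_of_finite F
    have hle : hermitianDual (Fintype.card F) (mpCode C A) ≤ mpCode C A :=
      sesqDual_mpCode_le (σ := (FiniteField.frobeniusAlgHom F K : K →+* K)) hA hC hτ hdual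
    exact mpCode_inducesOptimalQLRC hN hδ hA hC hopt hle
      (exists_two_mul_finrank_eq (σ := (FiniteField.frobeniusAlgHom F K : K →+* K))
        (frobenius_frobenius hK) hle)
      fun hk hd => inducedHermitian hK hψ hle hk hd
  · intro C A hA hopt hC hτ hdual
    have hle : euclideanDual (mpCode C A) ≤ mpCode C A :=
      sesqDual_mpCode_le (σ := RingHom.id F) hA hC
        (by simpa only [RingHom.coe_id, Matrix.map_id] using hτ) hdual
    exact mpCode_inducesOptimalQLRC hN hδ hA hC hopt hle
      (exists_two_mul_finrank_eq (σ := RingHom.id F) (fun _ => rfl) hle)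
      fun hk hd => inducedEuclidean hψ hle hk hd
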